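/- Setting. Let $X$ be a measurable space with a nonzero finite base measure $\nu$, and let $t:X\to\mathbb R^n$ be measurable with $\|t(x)\|_2\le R_2$ for all $x$, where $R_2>0$. Let $p_\theta$ be the exponential family with $\nu$-density $\exp(\theta\cdot t(x)-A(\theta))$, $A(\theta)=\log\int e^{\theta\cdot t}\,d\nu$. For data $z_1,\dots,z_N\in X$ ($N\ge1$) and $\lambda\ge0$ put $\bar t=\frac1N\sum_i t(z_i)$, $$f(\theta)=-\frac1N\sum_{i=1}^N\log p_\theta(z_i)+\frac\lambda2\|\theta\|_2^2,\qquad L=4R_2^2+\lambda .$$ Let $\Theta\subseteq\mathbb R^n$ be closed and convex, $\theta^*\in\arg\min_{\theta\in\Theta}f(\theta)$, and let $\theta_0\in\mathbb R^n$ be the starting point. For each $\theta$ let $\mathbb M_\theta$ be a Markov transition operator on $X$ (its kernel jointly measurable in $\theta$ and the state) such that, with constants $C>0$ and $\alpha\in(0,1)$, $\|\mathbb M_\theta^w q-p_\theta\|_{TV}\le C\alpha^w$ for all $\theta\in\Theta\cup\{\theta_0\}$, all probability distributions $q$ and all $w\in\{0,1,2,\dots\}$. Fix a probability distribution $r$ on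 $X$. The algorithm with positive integer parameters $K,M,v$ does the following for $k=1,\dots,K$: it draws, independently given the past, $x_1^{k-1},\dots,x_M^{k-1}\sim\mathbb M_{\theta_{k-1}}^v r$ and sets $$\theta_k=\Pi_\Theta\Big[\theta_{k-1}-\tfrac1L\Big(\tfrac1M\sum_{i=1}^M t(x_i^{k-1})-\bar t+\lambda\theta_{k-1}\Big)\Big],$$ where $\Pi_\Theta$ is the Euclidean projection onto $\Theta$. It uses $KMv$ Markov transitions in total. Theorem. Let $\delta\in(0,1)$, let $\beta_1,\beta_2,\beta_3>0$ with $\beta_1+\beta_2+\beta_3=1$, and let $D\ge\max\left(\|\theta_0-\theta^*\|_2,\frac{4R_2}{L}\log\frac1\delta\right)$. Then for every $\epsilon_f>0$ there are positive integers $K,M,v$, depending only on $R_2,\lambda,C,\alpha,\delta,D,\beta_1,\beta_2,\beta_3,\epsilon_f$, such that $$f\Big(\frac1K\sum_{k=1}^K\theta_k\Big)-f(\theta^*)\le\epsilon_f\quad\text{with probability at least }1-\delta ,$$ and such that, whenever the three real numbers $$\frac{2LD^2}{\beta_1^2\epsilon_f},\qquad \Big(\frac{4DR_2}{\beta_1\beta_2\epsilon_f}\Big)^2,\qquad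 \frac{1}{1-\alpha}\log\frac{4DR_2C}{\beta_1\beta_3\epsilon_f}$$ are all at least $1$ (which holds for all sufficiently small $\epsilon_f$), the total number of Markov transitions satisfies $$KMv\le\frac{32LR_2^2D^4}{\beta_1^4\beta_2^2\epsilon_f^3(1-\alpha)}\log\frac{4DR_2C}{\beta_1\beta_3\epsilon_f}.$$ -/

import Mathlib

open MeasureTheory ProbabilityTheory

namespace MCMCLearning

noncomputable section

/-- Parameter space: `ℝⁿ` with the Euclidean norm. -/
abbrev Param (n : ℕ) : Type := EuclideanSpace ℝ (Fin n)

/-- Log-partition function `A(θ) = log ∫ exp(θ · t(x)) dν(x)`. -/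
def logPartition {n : ℕ} {X : Type*} [MeasurableSpace X] (ν : Measure X) (t : X → Param n)
    (θ : Param n) : ℝ :=
  Real.log (∫ x, Real.exp (inner ℝ θ (t x)) ∂ν)

/-- Density `exp(θ · t(x) - A(θ))` of the exponential family with respect to the base measure
`ν`. -/
def density {n : ℕ} {X : Type*} [MeasurableSpace X] (ν : Measure X) (t : X → Param n)
    (θ : Param n) (x : X) : ℝ :=
  Real.exp (inner ℝ θ (t x) - logPartition ν t θ)

/-- The distribution `p_θ` on `X`. -/
def expFamily {n : ℕ} {X : Type*} [MeasurableSpace X] (ν : Measure X) (t : X → Param n)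
    (θ : Param n) : Measure X :=
  ν.withDensity fun x => ENNReal.ofReal (density ν t θ x)

/-- Regularized negative log-likelihood
`f(θ) = -(1/N) ∑ᵢ log p_θ(zᵢ) + (λ/2) ‖θ‖²` of the data `z₁, …, z_N`. -/
def objective {n N : ℕ} {X : Type*} [MeasurableSpace X] (ν : Measure X) (t : X → Param n)
    (z : Fin N → X) (lam : ℝ) (θ : Param n) : ℝ :=
  -((N : ℝ)⁻¹ * ∑ i, Real.log (density ν t θ (z i))) + lam / 2 * ‖θ‖ ^ 2

/-- Empirical mean `t̄ = (1/N) ∑ᵢ t(zᵢ)` of the sufficient statistics. -/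
def meanStat {n N : ℕ} {X : Type*} (t : X → Param n) (z : Fin N → X) : Param n :=
  (N : ℝ)⁻¹ • ∑ i, t (z i)

/-- Total-variation distance `sup_A |p(A) - q(A)|` over measurable sets. -/
def tvDist {X : Type*} [MeasurableSpace X] (p q : Measure X) : ℝ :=
  ⨆ A : {A : Set X // MeasurableSet A}, |p.real A - q.real A|

/-- `𝕄_θ^v q`: the law after `v` transitions of the chain with parameter `θ`, started from `q`.
The kernel `κ` sends `(θ, x)` to the law of the next state of the chain with parameter `θ` that is
now at `x`. -/
def chainLaw {n : ℕ} {X : Type*} [MeasurableSpace X] (κ : Kernel (Param n × X) X) (θ : Param n)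
    (v : ℕ) (q : Measure X) : Measure X :=
  (fun μ : Measure X => μ.bind fun x => κ (θ, x))^[v] q

open Classical in
/-- Euclidean projection `Π_Θ[φ] = argmin_{θ ∈ Θ} ‖θ - φ‖` (it exists and is unique when `Θ` is
nonempty, closed and convex; the `else` branch is then never used). -/
def proj {n : ℕ} (Θ : Set (Param n)) (φ : Param n) : Param n :=
  if h : ∃ p ∈ Θ, ∀ θ ∈ Θ, ‖p - φ‖ ≤ ‖θ - φ‖ then h.choose else φ

/-- Estimated gradient `(1/M) ∑ᵢ t(xᵢ) - t̄ + λ θ` from a batch of `M` samples. -/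
def gradEstimate {n N M : ℕ} {X : Type*} (t : X → Param n) (z : Fin N → X) (lam : ℝ)
    (θ : Param n) (x : Fin M → X) : Param n :=
  (M : ℝ)⁻¹ • ∑ i, t (x i) - meanStat t z + lam • θ

/-- The parameter `θ_k` that the algorithm has reached when the batches of samples drawn in the
first `k` iterations are `ω 0, …, ω (k-1)`. -/
def iterate {n N M : ℕ} {X : Type*} (t : X → Param n) (z : Fin N → X) (lam L : ℝ)
    (Θ : Set (Param n)) (θ₀ : Param n) : (k : ℕ) → (Fin k → Fin M → X) → Param n
  | 0, _ => θ₀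
  | k + 1, ω =>
    let θ := iterate t z lam L Θ θ₀ k (Fin.init ω)
    proj Θ (θ - L⁻¹ • gradEstimate t z lam θ (ω (Fin.last k)))

/-- Joint law of all the samples drawn in the first `k` iterations: given the first `k` batches, the
next batch consists of `M` independent samples from `𝕄_{θ_k}^v r`. -/
def sampleLaw {n N : ℕ} {X : Type*} [MeasurableSpace X] (κ : Kernel (Param n × X) X)
    (r : Measure X) (t : X → Param n) (z : Fin N → X) (lam L : ℝ) (Θ : Set (Param n))
    (θ₀ : Param n) (M v : ℕ) : (k : ℕ) → Measure (Fin k → Fin M → X)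
  | 0 => Measure.dirac fun i => i.elim0
  | k + 1 =>
    (sampleLaw κ r t z lam L Θ θ₀ M v k).bind fun ω =>
      (Measure.pi fun _ : Fin M => chainLaw κ (iterate t z lam L Θ θ₀ k ω) v r).map
        fun x => Fin.snoc (α := fun _ => Fin M → X) ω x

/-- Averaged output `(1/K) ∑_{k=1}^K θ_k` of a run of `K` iterations with batches `ω`. -/
def averageIterate {n N M K : ℕ} {X : Type*} (t : X → Param n) (z : Fin N → X) (lam L : ℝ)
    (Θ : Set (Param n)) (θ₀ : Param n) (ω : Fin K → Fin M → X) : Param n :=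
  (K : ℝ)⁻¹ • ∑ k : Fin K,
    iterate t z lam L Θ θ₀ (k + 1) fun i : Fin (k + 1) => ω (Fin.castLE k.isLt i)

end

end MCMCLearning

namespace MCMCLearning

noncomputable section

/-! ### Exponential moments of a bounded statistic -/

section BoundedStatistic

variable {n : ℕ} {X : Type*} [MeasurableSpace X] {t : X → Param n} {R : ℝ}

/-! The algorithm is projected gradient descent on `f` with a noisy gradient, and only the norms of
the gradient errors matter. The map `h ↦ A(θ+h) - A(θ)` is the cumulant generating function of `t`
under `p_θ`. Jensen bounds it below by its linear part, and Hoeffding's lemma bounds it above with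
the extra term `R₂²‖h‖²/2`. This gives convexity and smoothness of `f` on all of `ℝⁿ` without
differentiating (`le_objective`, `objective_le`).

Let `S` be the sum of the error norms. An exact step never moves away from `θ*`, and an error `e`
costs at most `‖e‖/L` in distance, so the iterates stay within `D + S/L` of `θ*`. Telescoping the
one-step inequality bounds the gap of the average by `(LD²/2 + SD + S²/L)/K`, deterministically
(`objective_averageIterate_sub_le`).

Probability enters only through `S`. Given the past, a batch is i.i.d. from a law within `Cα^v` of
`p_θ`, so its error norm has mean at most `R₂/√M + 2R₂Cα^v` and is sub-Gaussian with variance proxy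
`R₂²/M`. These bounds are uniform in the past, so exponential moments multiply over iterations, and
Chernoff's bound controls `S` (`one_sub_le_measure_errorSum_lt`).

`K`, `M`, `v` are the integer parts of three reals whose product is exactly the claimed cost.
Rounding down loses accuracy, which slack in the constants pays for (`schedule_bound`). -/

lemma integrable_of_norm_le (μ : Measure X) [IsFiniteMeasure μ] (ht : Measurable t)
    (htR : ∀ x, ‖t x‖ ≤ R) : Integrable t μ :=
  Integrable.of_bound ht.aestronglyMeasurable R (.of_forall htR)

lemma inner_mem_Icc {X : Type*} {t : X → Param n} (htR : ∀ x, ‖t x‖ ≤ R) (h : Param n) (x : X) :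
    inner ℝ h (t x) ∈ Set.Icc (-(‖h‖ * R)) (‖h‖ * R) := by
  have h1 := abs_real_inner_le_norm h (t x)
  have h2 : ‖h‖ * ‖t x‖ ≤ ‖h‖ * R := by gcongr; exact htR x
  exact abs_le.1 (h1.trans h2)

lemma integrable_exp_inner (μ : Measure X) [IsFiniteMeasure μ] (ht : Measurable t)
    (htR : ∀ x, ‖t x‖ ≤ R) (h : Param n) :
    Integrable (fun x => Real.exp (inner ℝ h (t x))) μ := by
  refine Integrable.of_bound (by fun_prop) (Real.exp (‖h‖ * R)) (.of_forall fun x => ?_)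
  rw [Real.norm_eq_abs, Real.abs_exp]
  exact Real.exp_le_exp.2 (inner_mem_Icc htR h x).2

lemma integrable_inner_of_norm_le (μ : Measure X) [IsFiniteMeasure μ] (ht : Measurable t)
    (htR : ∀ x, ‖t x‖ ≤ R) (h : Param n) : Integrable (fun x => inner ℝ h (t x)) μ :=
  (integrable_of_norm_le μ ht htR).const_inner h

lemma exp_inner_integral_le (μ : Measure X) [IsProbabilityMeasure μ] (ht : Measurable t)
    (htR : ∀ x, ‖t x‖ ≤ R) (h : Param n) :
    Real.exp (inner ℝ h (∫ x, t x ∂μ)) ≤ ∫ x, Real.exp (inner ℝ h (t x)) ∂μ := by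
  rw [← integral_inner (integrable_of_norm_le μ ht htR) h]
  exact convexOn_exp.map_integral_le Real.continuous_exp.continuousOn isClosed_univ
    (.of_forall fun _ => Set.mem_univ _) (integrable_inner_of_norm_le μ ht htR h)
    (integrable_exp_inner μ ht htR h)

/-- Hoeffding's lemma for a random variable with values in an interval, not centred. -/
lemma integral_exp_mul_le_of_mem_Icc {Y : X → ℝ} {a b : ℝ} (hab : a ≤ b) (μ : Measure X)
    [IsProbabilityMeasure μ] (hY : Measurable Y) (hYb : ∀ x, Y x ∈ Set.Icc a b) (s : ℝ) :
    ∫ x, Real.exp (s * Y x) ∂μ ≤ Real.exp (s * ∫ x, Y x ∂μ + ((b - a) / 2) ^ 2 * s ^ 2 / 2) := by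
  have h := (hasSubgaussianMGF_of_mem_Icc hY.aemeasurable (.of_forall hYb) (μ := μ)).mgf_le s
  have h2 : mgf (fun ω ↦ Y ω - μ[Y]) μ s
      = Real.exp (-(s * ∫ x, Y x ∂μ)) * ∫ x, Real.exp (s * Y x) ∂μ := by
    rw [mgf, ← integral_const_mul]
    congr 1 with x
    rw [← Real.exp_add]
    ring_nf
  have hc : ((((‖b - a‖₊ / 2) ^ 2 : NNReal)) : ℝ) = ((b - a) / 2) ^ 2 := by
    push_cast
    rw [Real.norm_of_nonneg (by linarith)]
  rw [h2, hc] at h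
  rw [Real.exp_add]
  calc ∫ x, Real.exp (s * Y x) ∂μ
      = Real.exp (s * ∫ x, Y x ∂μ) *
          (Real.exp (-(s * ∫ x, Y x ∂μ)) * ∫ x, Real.exp (s * Y x) ∂μ) := by
        rw [← mul_assoc, ← Real.exp_add]; simp
    _ ≤ _ := by gcongr

lemma integral_exp_inner_le (μ : Measure X) [IsProbabilityMeasure μ] (hR : 0 ≤ R)
    (ht : Measurable t) (htR : ∀ x, ‖t x‖ ≤ R) (h : Param n) :
    ∫ x, Real.exp (inner ℝ h (t x)) ∂μ
      ≤ Real.exp (inner ℝ h (∫ x, t x ∂μ) + R ^ 2 / 2 * ‖h‖ ^ 2) := by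
  have hp : 0 ≤ ‖h‖ * R := by positivity
  have := integral_exp_mul_le_of_mem_Icc (by linarith) μ (Y := fun x => inner ℝ h (t x))
    (by fun_prop) (inner_mem_Icc htR h) 1
  rw [← integral_inner (integrable_of_norm_le μ ht htR) h]
  simp only [one_mul] at this
  convert this using 2
  ring

end BoundedStatistic

/-! ### Convexity and smoothness of the objective -/

lemma objective_eq {n N : ℕ} {X : Type*} [MeasurableSpace X] {ν : Measure X} {t : X → Param n}
    (z : Fin N → X) (hN : 0 < N) (lam : ℝ) (θ : Param n) :
    objective ν t z lam θ
      = logPartition ν t θ - inner ℝ θ (meanStat t z) + lam / 2 * ‖θ‖ ^ 2 := by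
  have hN' : (N : ℝ) ≠ 0 := by positivity
  simp only [objective, density, Real.log_exp, Finset.sum_sub_distrib, Finset.sum_const,
    Finset.card_univ, Fintype.card_fin, nsmul_eq_mul, meanStat, inner_smul_right, inner_sum]
  field_simp
  ring

section ExponentialFamily

variable {n N : ℕ} {X : Type*} [MeasurableSpace X] {ν : Measure X} [IsFiniteMeasure ν] [NeZero ν]
  {t : X → Param n} {R : ℝ}

lemma integral_exp_inner_pos (ht : Measurable t) (htR : ∀ x, ‖t x‖ ≤ R) (θ : Param n) :
    0 < ∫ x, Real.exp (inner ℝ θ (t x)) ∂ν :=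
  integral_exp_pos (integrable_exp_inner ν ht htR θ)

lemma expFamily_eq_tilted (ht : Measurable t) (htR : ∀ x, ‖t x‖ ≤ R) (θ : Param n) :
    expFamily ν t θ = ν.tilted fun x => inner ℝ θ (t x) := by
  simp only [expFamily, Measure.tilted, density, logPartition, Real.exp_sub,
    Real.exp_log (integral_exp_inner_pos ht htR θ)]

lemma isProbabilityMeasure_expFamily (ht : Measurable t) (htR : ∀ x, ‖t x‖ ≤ R) (θ : Param n) :
    IsProbabilityMeasure (expFamily ν t θ) := by
  rw [expFamily_eq_tilted ht htR]
  exact isProbabilityMeasure_tilted (integrable_exp_inner ν ht htR θ)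

/-- Changing measure from `ν` to `p_θ` turns the ratio of partition functions into an exponential
moment, to which Jensen and Hoeffding apply. -/
lemma logPartition_sub (ht : Measurable t) (htR : ∀ x, ‖t x‖ ≤ R) (θ φ : Param n) :
    logPartition ν t φ - logPartition ν t θ
      = Real.log (∫ x, Real.exp (inner ℝ (φ - θ) (t x)) ∂(expFamily ν t θ)) := by
  rw [expFamily_eq_tilted ht htR, integral_exp_tilted, logPartition, logPartition,
    ← Real.log_div (integral_exp_inner_pos ht htR φ).ne' (integral_exp_inner_pos ht htR θ).ne']
  congr 4 with x
  simp [inner_sub_left]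

lemma le_logPartition_sub (ht : Measurable t) (htR : ∀ x, ‖t x‖ ≤ R) (θ φ : Param n) :
    inner ℝ (φ - θ) (∫ x, t x ∂(expFamily ν t θ)) ≤ logPartition ν t φ - logPartition ν t θ := by
  have := isProbabilityMeasure_expFamily (ν := ν) ht htR θ
  rw [logPartition_sub ht htR, Real.le_log_iff_exp_le
    (integral_exp_pos (integrable_exp_inner _ ht htR _))]
  exact exp_inner_integral_le _ ht htR _

lemma logPartition_sub_le (hR : 0 ≤ R) (ht : Measurable t) (htR : ∀ x, ‖t x‖ ≤ R)
    (θ φ : Param n) :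
    logPartition ν t φ - logPartition ν t θ
      ≤ inner ℝ (φ - θ) (∫ x, t x ∂(expFamily ν t θ)) + R ^ 2 / 2 * ‖φ - θ‖ ^ 2 := by
  have := isProbabilityMeasure_expFamily (ν := ν) ht htR θ
  rw [logPartition_sub ht htR, Real.log_le_iff_le_exp
    (integral_exp_pos (integrable_exp_inner _ ht htR _))]
  exact integral_exp_inner_le _ hR ht htR _

/-- The gradient of the regularized negative log-likelihood. -/
def objectiveGrad (ν : Measure X) (t : X → Param n) (z : Fin N → X) (lam : ℝ) (θ : Param n) :
    Param n :=
  ∫ x, t x ∂(expFamily ν t θ) - meanStat t z + lam • θ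

lemma norm_sq_eq_add (θ φ : Param n) :
    ‖φ‖ ^ 2 = ‖θ‖ ^ 2 + 2 * inner ℝ (φ - θ) θ + ‖φ - θ‖ ^ 2 := by
  have := norm_add_sq_real (φ - θ) θ
  rw [sub_add_cancel] at this
  linarith

lemma le_objective (z : Fin N → X) (hN : 0 < N) {lam : ℝ} (hlam : 0 ≤ lam) (ht : Measurable t)
    (htR : ∀ x, ‖t x‖ ≤ R) (θ φ : Param n) :
    objective ν t z lam θ + inner ℝ (objectiveGrad ν t z lam θ) (φ - θ)
      ≤ objective ν t z lam φ := by
  have h := le_logPartition_sub (ν := ν) ht htR θ φ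
  have h2 : 0 ≤ lam * ‖φ - θ‖ ^ 2 := by positivity
  rw [objective_eq z hN, objective_eq z hN, objectiveGrad, norm_sq_eq_add θ φ, real_inner_comm (φ - θ)]
  simp only [inner_add_right, inner_sub_right, inner_smul_right]
  have h3 := inner_sub_left (𝕜 := ℝ) φ θ (meanStat t z)
  linarith

lemma objective_le (z : Fin N → X) (hN : 0 < N) {lam L : ℝ} (hL : R ^ 2 + lam ≤ L)
    (hR : 0 ≤ R) (ht : Measurable t) (htR : ∀ x, ‖t x‖ ≤ R) (θ φ : Param n) :
    objective ν t z lam φ ≤ objective ν t z lam θ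
      + inner ℝ (objectiveGrad ν t z lam θ) (φ - θ) + L / 2 * ‖φ - θ‖ ^ 2 := by
  have h := logPartition_sub_le (ν := ν) hR ht htR θ φ
  have h2 : (R ^ 2 + lam) * ‖φ - θ‖ ^ 2 ≤ L * ‖φ - θ‖ ^ 2 := by gcongr
  rw [objective_eq z hN, objective_eq z hN, objectiveGrad, norm_sq_eq_add θ φ, real_inner_comm (φ - θ)]
  simp only [inner_add_right, inner_sub_right, inner_smul_right]
  have h3 := inner_sub_left (𝕜 := ℝ) φ θ (meanStat t z)
  linarith

end ExponentialFamily

/-! ### Euclidean projection onto a closed convex set -/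

section Projection

variable {n : ℕ} {Θ : Set (Param n)}

lemma exists_isNearest (hne : Θ.Nonempty) (hc : IsClosed Θ) (φ : Param n) :
    ∃ p ∈ Θ, ∀ θ ∈ Θ, ‖p - φ‖ ≤ ‖θ - φ‖ := by
  obtain ⟨p, hp, hd⟩ := hc.exists_infDist_eq_dist hne φ
  refine ⟨p, hp, fun θ hθ => ?_⟩
  rw [← dist_eq_norm, ← dist_eq_norm, dist_comm p, dist_comm θ, ← hd]
  exact Metric.infDist_le_dist_of_mem hθ

lemma proj_spec (hne : Θ.Nonempty) (hc : IsClosed Θ) (φ : Param n) :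
    proj Θ φ ∈ Θ ∧ ∀ θ ∈ Θ, ‖proj Θ φ - φ‖ ≤ ‖θ - φ‖ := by
  rw [proj, dif_pos (exists_isNearest hne hc φ)]
  exact (exists_isNearest hne hc φ).choose_spec

lemma inner_sub_proj_le_zero (hc : IsClosed Θ) (hconv : Convex ℝ Θ) (φ : Param n)
    {θ : Param n} (hθ : θ ∈ Θ) : inner ℝ (φ - proj Θ φ) (θ - proj Θ φ) ≤ 0 := by
  have hne : Θ.Nonempty := ⟨θ, hθ⟩
  obtain ⟨hmem, hmin⟩ := proj_spec hne hc φ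
  refine (norm_eq_iInf_iff_real_inner_le_zero hconv hmem).1 ?_ θ hθ
  have : Nonempty Θ := hne.to_subtype
  refine le_antisymm (le_ciInf fun w => ?_) (ciInf_le ⟨0, ?_⟩ (⟨_, hmem⟩ : Θ))
  · rw [norm_sub_rev, norm_sub_rev φ]
    exact hmin w w.2
  · rintro _ ⟨w, rfl⟩
    positivity

/-- Test the variational inequality of each projection at the other one, add the two, and apply
Cauchy–Schwarz. -/
lemma norm_proj_sub_proj_le (hne : Θ.Nonempty) (hc : IsClosed Θ) (hconv : Convex ℝ Θ)
    (φ ψ : Param n) : ‖proj Θ φ - proj Θ ψ‖ ≤ ‖φ - ψ‖ := by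
  have h1 := inner_sub_proj_le_zero hc hconv φ (proj_spec hne hc ψ).1
  have h2 := inner_sub_proj_le_zero hc hconv ψ (proj_spec hne hc φ).1
  set p := proj Θ φ
  set q := proj Θ ψ
  have h3 : ‖p - q‖ ^ 2 ≤ inner ℝ (φ - ψ) (p - q) := by
    rw [← real_inner_self_eq_norm_sq]
    have e1 : inner ℝ (φ - p) (q - p) = - inner ℝ (φ - p) (p - q) := by
      rw [← inner_neg_right, neg_sub]
    have e2 : inner ℝ (φ - ψ) (p - q) - inner ℝ (p - q) (p - q)
        = inner ℝ (φ - p) (p - q) - inner ℝ (ψ - q) (p - q) := by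
      rw [← inner_sub_left, ← inner_sub_left]
      congr 1
      abel
    linarith
  have h4 := real_inner_le_norm (φ - ψ) (p - q)
  by_contra! hlt
  nlinarith [norm_nonneg (φ - ψ)]

lemma lipschitzWith_proj (hne : Θ.Nonempty) (hc : IsClosed Θ) (hconv : Convex ℝ Θ) :
    LipschitzWith 1 (proj Θ) :=
  LipschitzWith.of_dist_le_mul fun φ ψ => by
    simpa [dist_eq_norm] using norm_proj_sub_proj_le hne hc hconv φ ψ

end Projection

/-! ### Projected gradient descent with inexact gradients -/

section GradientDescent

/-- One inexact projected gradient step: `p` satisfies the variational inequality of the projection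
of `x - (g + e) / L`, with `e` the error of the gradient. -/
lemma gap_le_of_inexact_step {E : Type*} [NormedAddCommGroup E] [InnerProductSpace ℝ E]
    {F : E → ℝ} {L : ℝ} (hL : 0 < L) {x p y g e : E}
    (hp : inner ℝ (x - L⁻¹ • (g + e) - p) (y - p) ≤ 0)
    (hup : F p ≤ F x + inner ℝ g (p - x) + L / 2 * ‖p - x‖ ^ 2)
    (hlow : F x + inner ℝ g (y - x) ≤ F y) :
    F p - F y ≤ ‖e‖ * ‖p - y‖ + L / 2 * (‖x - y‖ ^ 2 - ‖p - y‖ ^ 2) := by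
  have h1 : inner ℝ (x - L⁻¹ • (g + e) - p) (y - p)
      = inner ℝ (x - p) (y - p) - L⁻¹ * (inner ℝ g (y - p) + inner ℝ e (y - p)) := by
    rw [← inner_add_left, ← real_inner_smul_left, ← inner_sub_left]
    congr 1
    abel
  have h2 : L * inner ℝ (x - p) (y - p) ≤ inner ℝ g (y - p) + inner ℝ e (y - p) := by
    have := mul_le_mul_of_nonneg_left hp hL.le
    rw [h1, mul_sub, mul_inv_cancel_left₀ hL.ne'] at this
    linarith
  have h3 : inner ℝ e (y - p) ≤ ‖e‖ * ‖p - y‖ := by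
    rw [norm_sub_rev p y]
    exact real_inner_le_norm _ _
  have h4 : ‖x - y‖ ^ 2 = ‖p - x‖ ^ 2 - 2 * inner ℝ (x - p) (y - p) + ‖p - y‖ ^ 2 := by
    have := norm_sub_sq_real (x - p) (y - p)
    rw [sub_sub_sub_cancel_right] at this
    rw [norm_sub_rev p x, norm_sub_rev p y]
    exact this
  have h5 : inner ℝ g (p - x) - inner ℝ g (y - x) = - inner ℝ g (y - p) := by
    rw [← inner_sub_right, ← inner_neg_right]
    congr 1
    abel
  rw [h4]
  linarith

variable {n N M : ℕ} {X : Type*} [MeasurableSpace X] {ν : Measure X} {t : X → Param n}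
  {z : Fin N → X} {lam L R D : ℝ} {Θ : Set (Param n)}

/-- Deviation of the batch mean of the sufficient statistic from its mean under `p_θ`; this is the
error of the estimated gradient. -/
def gradError (ν : Measure X) (t : X → Param n) (θ : Param n) (x : Fin M → X) : Param n :=
  (M : ℝ)⁻¹ • ∑ i, t (x i) - ∫ y, t y ∂(expFamily ν t θ)

lemma gradEstimate_eq (θ : Param n) (x : Fin M → X) :
    gradEstimate t z lam θ x = objectiveGrad ν t z lam θ + gradError ν t θ x := by
  simp only [gradEstimate, objectiveGrad, gradError]
  abel

/-- Total error of the estimated gradients of the first `k` iterations. -/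
def errorSum (ν : Measure X) (t : X → Param n) (z : Fin N → X) (lam L : ℝ) (Θ : Set (Param n))
    (θ₀ : Param n) : (k : ℕ) → (Fin k → Fin M → X) → ℝ
  | 0, _ => 0
  | k + 1, ω => errorSum ν t z lam L Θ θ₀ k (Fin.init ω) +
      ‖gradError ν t (iterate t z lam L Θ θ₀ k (Fin.init ω)) (ω (Fin.last k))‖

lemma errorSum_nonneg (θ₀ : Param n) : ∀ (k : ℕ) (ω : Fin k → Fin M → X),
    0 ≤ errorSum ν t z lam L Θ θ₀ k ω
  | 0, _ => le_rfl
  | k + 1, _ => add_nonneg (errorSum_nonneg θ₀ k _) (norm_nonneg _)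

variable [IsFiniteMeasure ν] [NeZero ν]

lemma step_le (hN : 0 < N) (hlam : 0 ≤ lam) (hL0 : 0 < L) (hL : R ^ 2 + lam ≤ L) (hR : 0 ≤ R)
    (ht : Measurable t) (htR : ∀ x, ‖t x‖ ≤ R) (hc : IsClosed Θ) (hconv : Convex ℝ Θ)
    {y : Param n} (hy : y ∈ Θ) (x e : Param n) :
    let p := proj Θ (x - L⁻¹ • (objectiveGrad ν t z lam x + e))
    objective ν t z lam p - objective ν t z lam y
      ≤ ‖e‖ * ‖p - y‖ + L / 2 * (‖x - y‖ ^ 2 - ‖p - y‖ ^ 2) :=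
  gap_le_of_inexact_step hL0 (inner_sub_proj_le_zero hc hconv _ hy)
    (objective_le z hN hL hR ht htR _ _) (le_objective z hN hlam ht htR _ _)

/-- Compare with the exact step `q`. Its gap to the minimizer is nonnegative, so the one-step
inequality with `e = 0` forbids moving away; the projection is nonexpansive, so the error shifts the
result by at most `‖e‖ / L`. -/
lemma norm_step_sub_le (hN : 0 < N) (hlam : 0 ≤ lam) (hL0 : 0 < L) (hL : R ^ 2 + lam ≤ L)
    (hR : 0 ≤ R) (ht : Measurable t) (htR : ∀ x, ‖t x‖ ≤ R) (hc : IsClosed Θ)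
    (hconv : Convex ℝ Θ) {y : Param n} (hy : y ∈ Θ)
    (hmin : IsMinOn (objective ν t z lam) Θ y) (x e : Param n) :
    ‖proj Θ (x - L⁻¹ • (objectiveGrad ν t z lam x + e)) - y‖ ≤ ‖x - y‖ + ‖e‖ / L := by
  set g := objectiveGrad ν t z lam x
  have hne : Θ.Nonempty := ⟨y, hy⟩
  set q := proj Θ (x - L⁻¹ • (g + 0)) with hq
  have h1 : ‖q - y‖ ≤ ‖x - y‖ := by
    have h := step_le (z := z) (ν := ν) hN hlam hL0 hL hR ht htR hc hconv hy x 0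
    have hge : objective ν t z lam y ≤ objective ν t z lam q :=
      hmin (proj_spec hne hc _).1
    simp only [norm_zero, zero_mul, zero_add] at h
    have h2 : 0 ≤ L / 2 * (‖x - y‖ ^ 2 - ‖q - y‖ ^ 2) := by
      refine le_trans ?_ h
      linarith
    have h3 := nonneg_of_mul_nonneg_right h2 (by positivity)
    exact (sq_le_sq₀ (norm_nonneg _) (norm_nonneg _)).1 (by linarith)
  have h2 : ‖proj Θ (x - L⁻¹ • (g + e)) - q‖ ≤ ‖e‖ / L := by
    refine (norm_proj_sub_proj_le hne hc hconv _ _).trans (le_of_eq ?_)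
    have : x - L⁻¹ • (g + e) - (x - L⁻¹ • (g + 0)) = - (L⁻¹ • e) := by
      rw [smul_add, add_zero]
      abel
    rw [this, norm_neg, norm_smul, norm_inv, Real.norm_of_nonneg hL0.le]
    ring
  calc ‖proj Θ (x - L⁻¹ • (g + e)) - y‖
      = ‖(q - y) + (proj Θ (x - L⁻¹ • (g + e)) - q)‖ := by congr 1; abel
    _ ≤ _ := (norm_add_le _ _).trans (add_le_add h1 h2)

/-- The squared distance telescopes, and the distance bound caps the factor that multiplies each new
error. -/
lemma norm_iterate_sub_le_and_sum_gap_le (hN : 0 < N) (hlam : 0 ≤ lam) (hL0 : 0 < L)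
    (hL : R ^ 2 + lam ≤ L) (hR : 0 ≤ R) (ht : Measurable t) (htR : ∀ x, ‖t x‖ ≤ R)
    (hc : IsClosed Θ) (hconv : Convex ℝ Θ) {y : Param n} (hy : y ∈ Θ)
    (hmin : IsMinOn (objective ν t z lam) Θ y) {θ₀ : Param n} (hD : ‖θ₀ - y‖ ≤ D) :
    ∀ (k : ℕ) (ω : Fin k → Fin M → X),
      ‖iterate t z lam L Θ θ₀ k ω - y‖ ≤ D + errorSum ν t z lam L Θ θ₀ k ω / L ∧
      ∑ j : Fin k, (objective ν t z lam
            (iterate t z lam L Θ θ₀ (j + 1) fun i : Fin (j + 1) => ω (Fin.castLE j.isLt i))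
          - objective ν t z lam y) + L / 2 * ‖iterate t z lam L Θ θ₀ k ω - y‖ ^ 2
        ≤ L / 2 * D ^ 2 + errorSum ν t z lam L Θ θ₀ k ω * D
          + errorSum ν t z lam L Θ θ₀ k ω ^ 2 / L := by
  intro k
  induction k with
  | zero =>
    intro ω
    simp only [iterate, errorSum]
    have : L / 2 * ‖θ₀ - y‖ ^ 2 ≤ L / 2 * D ^ 2 := by gcongr
    exact ⟨by simpa using hD, by simpa using this⟩
  | succ k ih =>
    intro ω
    obtain ⟨ih1, ih2⟩ := ih (Fin.init ω)
    set x := iterate t z lam L Θ θ₀ k (Fin.init ω) with hx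
    set e := gradError ν t x (ω (Fin.last k)) with he
    set S := errorSum ν t z lam L Θ θ₀ k (Fin.init ω) with hS
    have hS0 : 0 ≤ S := errorSum_nonneg θ₀ k _
    have hit : iterate t z lam L Θ θ₀ (k + 1) ω
        = proj Θ (x - L⁻¹ • (objectiveGrad ν t z lam x + e)) := by
      rw [iterate, ← hx, gradEstimate_eq (ν := ν)]
    have hes : errorSum ν t z lam L Θ θ₀ (k + 1) ω = S + ‖e‖ := rfl
    have h1 := step_le (z := z) (ν := ν) hN hlam hL0 hL hR ht htR hc hconv hy x e
    have h2 := norm_step_sub_le (z := z) (ν := ν) hN hlam hL0 hL hR ht htR hc hconv hy hmin x e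
    rw [← hit] at h1 h2
    simp only at h1
    have h3 : ‖iterate t z lam L Θ θ₀ (k + 1) ω - y‖ ≤ D + (S + ‖e‖) / L := by
      rw [add_div]
      linarith
    rw [Fin.sum_univ_castSucc, hes]
    refine ⟨h3, ?_⟩
    have h4 : ‖e‖ * ‖iterate t z lam L Θ θ₀ (k + 1) ω - y‖ ≤ ‖e‖ * (D + (S + ‖e‖) / L) := by
      gcongr
    -- The quadratic term in the claim has just enough room to absorb the new error times the
    -- accumulated drift.
    have h5 : ‖e‖ * ((S + ‖e‖) / L) + S ^ 2 / L ≤ (S + ‖e‖) ^ 2 / L := by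
      rw [mul_div_assoc', ← add_div]
      gcongr
      nlinarith [mul_nonneg hS0 (norm_nonneg e)]
    have h6 : ∀ A B : ℝ, A + L / 2 * ‖x - y‖ ^ 2 ≤ L / 2 * D ^ 2 + S * D + S ^ 2 / L →
        B ≤ ‖e‖ * ‖iterate t z lam L Θ θ₀ (k + 1) ω - y‖
          + L / 2 * (‖x - y‖ ^ 2 - ‖iterate t z lam L Θ θ₀ (k + 1) ω - y‖ ^ 2) →
        A + B + L / 2 * ‖iterate t z lam L Θ θ₀ (k + 1) ω - y‖ ^ 2
          ≤ L / 2 * D ^ 2 + (S + ‖e‖) * D + (S + ‖e‖) ^ 2 / L := by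
      intro A B hA hB
      linarith
    exact h6 _ _ ih2 h1

/-- Sum the tangent inequalities at the average: the linear terms cancel. -/
lemma objective_average_le (hN : 0 < N) (hlam : 0 ≤ lam) (ht : Measurable t)
    (htR : ∀ x, ‖t x‖ ≤ R) {K : ℕ} (hK : 0 < K) (θ : Fin K → Param n) :
    objective ν t z lam ((K : ℝ)⁻¹ • ∑ k, θ k)
      ≤ (K : ℝ)⁻¹ * ∑ k, objective ν t z lam (θ k) := by
  have hK' : (K : ℝ) ≠ 0 := by positivity
  set m := (K : ℝ)⁻¹ • ∑ k, θ k with hm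
  have h := Finset.sum_le_sum fun k (_ : k ∈ Finset.univ) =>
    le_objective (ν := ν) z hN hlam ht htR m (θ k)
  have h0 : ∑ k, (θ k - m) = 0 := by
    rw [Finset.sum_sub_distrib, Finset.sum_const, Finset.card_univ, Fintype.card_fin, hm,
      ← Nat.cast_smul_eq_nsmul ℝ, smul_inv_smul₀ hK', sub_self]
  rw [Finset.sum_add_distrib, ← inner_sum, h0, inner_zero_right, add_zero, Finset.sum_const,
    Finset.card_univ, Fintype.card_fin, nsmul_eq_mul] at h
  rwa [le_inv_mul_iff₀ (by positivity)]

theorem objective_averageIterate_sub_le (hN : 0 < N) (hlam : 0 ≤ lam) (hL0 : 0 < L)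
    (hL : R ^ 2 + lam ≤ L) (hR : 0 ≤ R) (ht : Measurable t) (htR : ∀ x, ‖t x‖ ≤ R)
    (hc : IsClosed Θ) (hconv : Convex ℝ Θ) {y : Param n} (hy : y ∈ Θ)
    (hmin : IsMinOn (objective ν t z lam) Θ y) {θ₀ : Param n} (hD : ‖θ₀ - y‖ ≤ D) {K : ℕ}
    (hK : 0 < K) (ω : Fin K → Fin M → X) :
    objective ν t z lam (averageIterate t z lam L Θ θ₀ ω) - objective ν t z lam y
      ≤ (K : ℝ)⁻¹ * (L / 2 * D ^ 2 + errorSum ν t z lam L Θ θ₀ K ω * D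
          + errorSum ν t z lam L Θ θ₀ K ω ^ 2 / L) := by
  have hK' : (0 : ℝ) < K := by positivity
  have h1 := (norm_iterate_sub_le_and_sum_gap_le hN hlam hL0 hL hR ht htR hc hconv hy hmin hD
    K ω).2
  have h2 := objective_average_le (ν := ν) (z := z) hN hlam ht htR hK fun k : Fin K =>
    iterate t z lam L Θ θ₀ (k + 1) fun i : Fin (k + 1) => ω (Fin.castLE k.isLt i)
  rw [Finset.sum_sub_distrib, Finset.sum_const, Finset.card_univ, Fintype.card_fin,
    nsmul_eq_mul] at h1
  rw [averageIterate, sub_le_iff_le_add]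
  refine h2.trans ?_
  rw [inv_mul_le_iff₀ hK', mul_add, mul_inv_cancel_left₀ hK'.ne']
  have h3 : 0 ≤ L / 2 * ‖iterate t z lam L Θ θ₀ K ω - y‖ ^ 2 := by positivity
  linarith

end GradientDescent

/-! ### Total variation controls the bias of the mean statistic -/

section TotalVariation

variable {n : ℕ} {X : Type*} [MeasurableSpace X]

lemma abs_measureReal_sub_le_tvDist (p q : Measure X) [IsProbabilityMeasure p]
    [IsProbabilityMeasure q] {A : Set X} (hA : MeasurableSet A) :
    |p.real A - q.real A| ≤ tvDist p q := by
  refine le_ciSup (f := fun A : {A : Set X // MeasurableSet A} => |p.real A - q.real A|)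
    ⟨1, ?_⟩ ⟨A, hA⟩
  rintro _ ⟨B, rfl⟩
  have h1 := measureReal_le_one (μ := p) (s := (B : Set X))
  have h2 := measureReal_le_one (μ := q) (s := (B : Set X))
  have h3 := measureReal_nonneg (μ := p) (s := (B : Set X))
  have h4 := measureReal_nonneg (μ := q) (s := (B : Set X))
  exact abs_le.2 ⟨by linarith, by linarith⟩

/-- Layer cake: both expectations integrate the measures of the superlevel sets of `Y` over `(0,
b]`, and these differ by at most the distance at each level. -/
lemma abs_integral_sub_le_tvDist (p q : Measure X) [IsProbabilityMeasure p]
    [IsProbabilityMeasure q] {Y : X → ℝ} {b : ℝ} (hb : 0 ≤ b) (hY : Measurable Y)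
    (hYb : ∀ x, Y x ∈ Set.Icc 0 b) : |∫ x, Y x ∂p - ∫ x, Y x ∂q| ≤ b * tvDist p q := by
  have key : ∀ (m : Measure X) [IsProbabilityMeasure m],
      ∫ x, Y x ∂m = ∫ s in Set.Ioc 0 b, m.real {x | s ≤ Y x} := fun m _ =>
    (Integrable.of_mem_Icc 0 b hY.aemeasurable (.of_forall hYb)).integral_eq_integral_Ioc_meas_le
      (.of_forall fun x => (hYb x).1) (.of_forall fun x => (hYb x).2)
  have hint : ∀ (m : Measure X) [IsProbabilityMeasure m],
      IntegrableOn (fun s => m.real {x | s ≤ Y x}) (Set.Ioc 0 b) := fun m _ => by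
    have hanti : Antitone fun s => m.real {x | s ≤ Y x} := fun s s' h =>
      measureReal_mono fun x (hx : s' ≤ Y x) => h.trans hx
    exact Integrable.of_bound hanti.measurable.aestronglyMeasurable 1
      (.of_forall fun s => by
        rw [Real.norm_of_nonneg measureReal_nonneg]; exact measureReal_le_one)
  rw [key p, key q, ← integral_sub (hint p) (hint q), ← Real.norm_eq_abs]
  refine (norm_setIntegral_le_of_norm_le_const (C := tvDist p q) measure_Ioc_lt_top
    fun s _ => ?_).trans (le_of_eq ?_)
  · exact abs_measureReal_sub_le_tvDist p q (measurableSet_le measurable_const hY)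
  · simp [hb, mul_comm]

/-- Test against the difference `u` of the means itself. The shift by `‖u‖ * R` puts the scalar
function in `[0, 2‖u‖R]`; then divide by `‖u‖`. -/
lemma norm_integral_sub_le_tvDist (p q : Measure X) [IsProbabilityMeasure p]
    [IsProbabilityMeasure q] {t : X → Param n} {R : ℝ} (hR : 0 ≤ R) (ht : Measurable t)
    (htR : ∀ x, ‖t x‖ ≤ R) : ‖∫ x, t x ∂p - ∫ x, t x ∂q‖ ≤ 2 * R * tvDist p q := by
  set u := ∫ x, t x ∂p - ∫ x, t x ∂q with hu
  have h := abs_integral_sub_le_tvDist p q (Y := fun x => inner ℝ u (t x) + ‖u‖ * R)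
    (b := 2 * (‖u‖ * R)) (by positivity) (by fun_prop) fun x => by
      have := inner_mem_Icc htR u x
      exact ⟨by linarith [this.1], by linarith [this.2]⟩
  rw [integral_add (integrable_inner_of_norm_le p ht htR u) (integrable_const _),
    integral_add (integrable_inner_of_norm_le q ht htR u) (integrable_const _),
    integral_inner (integrable_of_norm_le p ht htR),
    integral_inner (integrable_of_norm_le q ht htR)] at h
  simp only [integral_const, probReal_univ, one_smul, add_sub_add_right_eq_sub] at h
  rw [← inner_sub_right, ← hu, real_inner_self_eq_norm_sq, abs_of_nonneg (by positivity)] at h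
  rcases (norm_nonneg u).eq_or_lt with h0 | h0
  · rw [← h0]
    have := (abs_nonneg _).trans (abs_measureReal_sub_le_tvDist p q MeasurableSet.univ)
    positivity
  · refine le_of_mul_le_mul_left ?_ h0
    linarith

end TotalVariation

/-! ### Concentration of the batch mean -/

section BatchConcentration

variable {n : ℕ} {X : Type*} [MeasurableSpace X] {t : X → Param n} {R : ℝ}

lemma integrable_comp_sum {ι : Type*} [Fintype ι] (μ : Measure (ι → X)) [IsFiniteMeasure μ]
    (ht : Measurable t) (htR : ∀ x, ‖t x‖ ≤ R) {G : Param n → ℝ} (hG : Continuous G) :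
    Integrable (fun x => G (∑ i, t (x i))) μ := by
  obtain ⟨B, hB⟩ := (isCompact_closedBall (0 : Param n) (Fintype.card ι * R)).exists_bound_of_continuousOn
    hG.continuousOn
  refine Integrable.of_bound (C := B) ?_ (.of_forall fun x => hB _ ?_)
  · exact (hG.measurable.comp (by fun_prop)).aestronglyMeasurable
  · rw [mem_closedBall_zero_iff]
    refine (norm_sum_le _ _).trans ((Finset.sum_le_sum fun i _ => htR (x i)).trans ?_)
    simp

lemma integral_pi_succ_sum {m : ℕ} (μ : Measure X) [IsProbabilityMeasure μ]
    (ht : Measurable t) (htR : ∀ x, ‖t x‖ ≤ R) {G : Param n → ℝ} (hG : Continuous G) :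
    ∫ x, G (∑ i, t (x i)) ∂(Measure.pi fun _ : Fin (m + 1) => μ)
      = ∫ y, ∫ x, G (t y + ∑ i, t (x i)) ∂(Measure.pi fun _ : Fin m => μ) ∂μ := by
  have h := measurePreserving_piFinSuccAbove (fun _ : Fin (m + 1) => μ) 0
  have hi := integrable_comp_sum (Measure.pi fun _ : Fin (m + 1) => μ) ht htR hG
  have e : (fun x : Fin (m + 1) → X => G (∑ i, t (x i)))
      = fun x => (fun z : X × (Fin m → X) => G (t z.1 + ∑ i, t (z.2 i)))
        (MeasurableEquiv.piFinSuccAbove (fun _ => X) 0 x) := by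
    funext x
    simp only [Fin.sum_univ_succ]
    rfl
  rw [e] at hi ⊢
  rw [h.integral_comp' (fun z : X × (Fin m → X) => G (t z.1 + ∑ i, t (z.2 i))), integral_prod]
  exact (h.integrable_comp_emb (MeasurableEquiv.measurableEmbedding _)).1 hi

lemma integrable_add_comp_sum {m : ℕ} (μ : Measure X) [IsProbabilityMeasure μ]
    (ht : Measurable t) (htR : ∀ x, ‖t x‖ ≤ R) {G : Param n → ℝ} (hG : Continuous G)
    (y : Param n) :
    Integrable (fun x => G (y + ∑ i, t (x i))) (Measure.pi fun _ : Fin m => μ) :=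
  integrable_comp_sum _ ht htR (G := fun w => G (y + w)) (by fun_prop)

lemma lipschitzWith_integral_add_sum {m : ℕ} (μ : Measure X) [IsProbabilityMeasure μ]
    (ht : Measurable t) (htR : ∀ x, ‖t x‖ ≤ R) {φ : Param n → ℝ} (hφ : LipschitzWith 1 φ) :
    LipschitzWith 1 fun y => ∫ x, φ (y + ∑ i, t (x i)) ∂(Measure.pi fun _ : Fin m => μ) := by
  refine LipschitzWith.of_dist_le_mul fun y y' => ?_
  rw [Real.dist_eq, ← integral_sub (integrable_add_comp_sum μ ht htR hφ.continuous y)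
    (integrable_add_comp_sum μ ht htR hφ.continuous y'), ← Real.norm_eq_abs]
  refine (norm_integral_le_of_norm_le_const (C := (1 : NNReal) * dist y y')
    (.of_forall fun x => ?_)).trans (le_of_eq ?_)
  · have := hφ.dist_le_mul (y + ∑ i, t (x i)) (y' + ∑ i, t (x i))
    rwa [dist_add_right] at this
  · simp

/-- Sub-Gaussian moment bound for a Lipschitz function of a sum of independent bounded vectors. -/
lemma integral_exp_lipschitz_sum_le (μ : Measure X) [IsProbabilityMeasure μ] (hR : 0 ≤ R)
    (ht : Measurable t) (htR : ∀ x, ‖t x‖ ≤ R) (s : ℝ) (m : ℕ) :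
    ∀ φ : Param n → ℝ, LipschitzWith 1 φ →
      ∫ x, Real.exp (s * φ (∑ i, t (x i))) ∂(Measure.pi fun _ : Fin m => μ)
        ≤ Real.exp (s * ∫ x, φ (∑ i, t (x i)) ∂(Measure.pi fun _ : Fin m => μ)
            + m * R ^ 2 * s ^ 2 / 2) := by
  induction m with
  | zero => intro φ _; simp
  | succ m ih =>
    intro φ hφ
    have hφc : Continuous φ := hφ.continuous
    -- Condition on the first sample. The conditional mean `ψ` is again 1-Lipschitz, so `ψ (t x)`
    -- stays within `R` of `ψ 0`, and Hoeffding's lemma adds `R² s² / 2` to the exponent. The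
    -- induction hypothesis for the shifted function handles the other samples.
    set ψ : Param n → ℝ := fun y => ∫ x, φ (y + ∑ i, t (x i)) ∂(Measure.pi fun _ : Fin m => μ)
      with hψ
    have hψL : LipschitzWith 1 ψ := lipschitzWith_integral_add_sum μ ht htR hφ
    have hψc : Continuous ψ := hψL.continuous
    rw [integral_pi_succ_sum μ ht htR (G := fun w => Real.exp (s * φ w)) (by fun_prop),
      integral_pi_succ_sum μ ht htR hφc]
    change _ ≤ Real.exp (s * ∫ y, ψ (t y) ∂μ + _)
    have hb : ∀ x, ψ (t x) ∈ Set.Icc (ψ 0 - R) (ψ 0 + R) := fun x => by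
      have h1 := hψL.dist_le_mul (t x) 0
      rw [dist_zero_right, Real.dist_eq, NNReal.coe_one, one_mul] at h1
      have h2 := abs_le.1 (h1.trans (htR x))
      exact ⟨by linarith [h2.1], by linarith [h2.2]⟩
    have hH := integral_exp_mul_le_of_mem_Icc (by linarith) μ (Y := fun x => ψ (t x))
      (hψc.measurable.comp ht) hb s
    have hle : ∀ y, ∫ x, Real.exp (s * φ (t y + ∑ i, t (x i))) ∂(Measure.pi fun _ : Fin m => μ)
        ≤ Real.exp (s * ψ (t y)) * Real.exp (m * R ^ 2 * s ^ 2 / 2) := fun y => by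
      rw [← Real.exp_add]
      exact ih (fun w => φ (t y + w)) (LipschitzWith.of_dist_le_mul fun w w' => by
        simpa using hφ.dist_le_mul (t y + w) (t y + w'))
    have hint : Integrable (fun y => Real.exp (s * ψ (t y))) μ := by
      refine Integrable.of_bound (C := Real.exp (|s| * (|ψ 0| + R)))
        ((Real.continuous_exp.comp (hψc.const_mul s)).measurable.comp ht).aestronglyMeasurable
        (.of_forall fun y => ?_)
      rw [Real.norm_eq_abs, Real.abs_exp]
      refine Real.exp_le_exp.2 ((le_abs_self _).trans ?_)
      rw [abs_mul]
      gcongr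
      rw [abs_le]
      have := hb y
      exact ⟨by linarith [this.1, neg_abs_le (ψ 0)], by linarith [this.2, le_abs_self (ψ 0)]⟩
    calc _ ≤ ∫ y, Real.exp (s * ψ (t y)) * Real.exp (m * R ^ 2 * s ^ 2 / 2) ∂μ :=
          integral_mono_of_nonneg (.of_forall fun y => integral_nonneg fun x => (Real.exp_pos _).le)
            (hint.mul_const _) (.of_forall hle)
      _ = (∫ y, Real.exp (s * ψ (t y)) ∂μ) * Real.exp (m * R ^ 2 * s ^ 2 / 2) :=
          integral_mul_const _ _
      _ ≤ Real.exp (s * ∫ y, ψ (t y) ∂μ + ((ψ 0 + R - (ψ 0 - R)) / 2) ^ 2 * s ^ 2 / 2)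
            * Real.exp (m * R ^ 2 * s ^ 2 / 2) := by gcongr
      _ = _ := by
          rw [← Real.exp_add]
          push_cast
          ring_nf

/-- Cross terms vanish because the summands are independent and centred. The base point `y` is there
to carry the induction. -/
lemma integral_norm_add_sum_sq_le (μ : Measure X) [IsProbabilityMeasure μ] (ht : Measurable t)
    (htR : ∀ x, ‖t x‖ ≤ R) (h0 : ∫ x, t x ∂μ = 0) (m : ℕ) :
    ∀ y : Param n, ∫ x, ‖y + ∑ i, t (x i)‖ ^ 2 ∂(Measure.pi fun _ : Fin m => μ)
      ≤ ‖y‖ ^ 2 + m * ∫ x, ‖t x‖ ^ 2 ∂μ := by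
  have hsq : Integrable (fun x => ‖t x‖ ^ 2) μ :=
    Integrable.of_bound (by fun_prop) (R ^ 2) (.of_forall fun x => by
      rw [norm_pow, norm_norm]
      gcongr
      exact htR x)
  induction m with
  | zero => intro y; simp
  | succ m ih =>
    intro y
    have hin : Integrable (fun a => 2 * inner ℝ y (t a)) μ :=
      (integrable_inner_of_norm_le μ ht htR y).const_mul 2
    have hi1 : Integrable (fun a => ‖y‖ ^ 2 + ‖t a‖ ^ 2) μ := (integrable_const _).add hsq
    have hi : Integrable (fun a => ‖y‖ ^ 2 + ‖t a‖ ^ 2 + 2 * inner ℝ y (t a)) μ := hi1.add hin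
    rw [integral_pi_succ_sum μ ht htR (G := fun w => ‖y + w‖ ^ 2) (by fun_prop)]
    calc ∫ a, ∫ x, ‖y + (t a + ∑ i, t (x i))‖ ^ 2 ∂(Measure.pi fun _ : Fin m => μ) ∂μ
        ≤ ∫ a, ((‖y‖ ^ 2 + ‖t a‖ ^ 2 + 2 * inner ℝ y (t a))
            + m * ∫ x, ‖t x‖ ^ 2 ∂μ) ∂μ := by
          refine integral_mono_of_nonneg (.of_forall fun a => integral_nonneg fun x => by positivity)
            (hi.add (integrable_const _)) (.of_forall fun a => ?_)
          have := ih (y + t a)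
          simp only [add_assoc] at this
          refine this.trans (le_of_eq ?_)
          rw [norm_add_sq_real]
          ring
      _ = _ := by
          rw [integral_add hi (integrable_const _), integral_add hi1 hin,
            integral_add (integrable_const _) hsq, integral_const_mul,
            integral_inner (integrable_of_norm_le μ ht htR), h0]
          simp
          ring

lemma integral_norm_sub_integral_sq_le (μ : Measure X) [IsProbabilityMeasure μ]
    (ht : Measurable t) (htR : ∀ x, ‖t x‖ ≤ R) :
    ∫ x, ‖t x - ∫ y, t y ∂μ‖ ^ 2 ∂μ ≤ R ^ 2 := by
  set E := ∫ y, t y ∂μ with hE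
  have hin : Integrable (fun x => 2 * inner ℝ E (t x)) μ :=
    (integrable_inner_of_norm_le μ ht htR E).const_mul 2
  have hi1 : Integrable (fun x => R ^ 2 - 2 * inner ℝ E (t x)) μ := (integrable_const _).sub hin
  have hi : Integrable (fun x => R ^ 2 - 2 * inner ℝ E (t x) + ‖E‖ ^ 2) μ :=
    hi1.add (integrable_const _)
  calc ∫ x, ‖t x - E‖ ^ 2 ∂μ
      ≤ ∫ x, (R ^ 2 - 2 * inner ℝ E (t x) + ‖E‖ ^ 2) ∂μ := by
        refine integral_mono_of_nonneg (.of_forall fun x => by positivity) hi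
          (.of_forall fun x => ?_)
        have : ‖t x‖ ^ 2 ≤ R ^ 2 := by gcongr; exact htR x
        simp only [norm_sub_sq_real, real_inner_comm E]
        linarith
    _ = R ^ 2 - ‖E‖ ^ 2 := by
        rw [integral_add hi1 (integrable_const _), integral_sub (integrable_const _) hin,
          integral_const_mul, integral_inner (integrable_of_norm_le μ ht htR), ← hE,
          real_inner_self_eq_norm_sq]
        simp
        ring
    _ ≤ R ^ 2 := by linarith [sq_nonneg ‖E‖]

lemma integral_norm_sum_sub_le (μ : Measure X) [IsProbabilityMeasure μ] (hR : 0 < R)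
    (ht : Measurable t) (htR : ∀ x, ‖t x‖ ≤ R) {m : ℕ} (hm : 0 < m) (c : Param n) :
    ∫ x, ‖∑ i, t (x i) - (m : ℝ) • c‖ ∂(Measure.pi fun _ : Fin m => μ)
      ≤ R * √m + m * ‖∫ x, t x ∂μ - c‖ := by
  set E := ∫ x, t x ∂μ with hE
  have hτ : Measurable fun x => t x - E := ht.sub_const E
  have hτR : ∀ x, ‖t x - E‖ ≤ R + ‖E‖ := fun x =>
    (norm_sub_le _ _).trans (add_le_add_left (htR x) _)
  have hτ0 : ∫ x, (t x - E) ∂μ = 0 := by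
    rw [integral_sub (integrable_of_norm_le μ ht htR) (integrable_const _)]
    simp [hE]
  have h2 := integral_norm_add_sum_sq_le μ hτ hτR hτ0 m 0
  have hv := integral_norm_sub_integral_sq_le μ ht htR
  rw [← hE] at hv
  simp only [zero_add, norm_zero, ne_eq, OfNat.ofNat_ne_zero, not_false_eq_true, zero_pow] at h2
  have h3 : ∫ x, ‖∑ i, (t (x i) - E)‖ ^ 2 ∂(Measure.pi fun _ : Fin m => μ) ≤ m * R ^ 2 :=
    h2.trans (by gcongr)
  set a := R * √m with ha
  have ha0 : 0 < a := by positivity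
  have ha2 : a ^ 2 = m * R ^ 2 := by
    rw [ha, mul_pow, Real.sq_sqrt (by positivity), mul_comm]
  have hI1 := integrable_comp_sum (Measure.pi fun _ : Fin m => μ) hτ hτR
    (G := fun w => ‖w‖ ^ 2) (by fun_prop)
  calc ∫ x, ‖∑ i, t (x i) - (m : ℝ) • c‖ ∂(Measure.pi fun _ : Fin m => μ)
      ≤ ∫ x, ((2 * a)⁻¹ * ‖∑ i, (t (x i) - E)‖ ^ 2 + (a / 2 + m * ‖E - c‖))
          ∂(Measure.pi fun _ : Fin m => μ) := by
        refine integral_mono_of_nonneg (.of_forall fun x => norm_nonneg _)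
          ((hI1.const_mul _).add (integrable_const _)) (.of_forall fun x => ?_)
        have e : ∑ i, t (x i) - (m : ℝ) • c = ∑ i, (t (x i) - E) + (m : ℝ) • (E - c) := by
          rw [Finset.sum_sub_distrib, Finset.sum_const, Finset.card_univ, Fintype.card_fin,
            smul_sub, ← Nat.cast_smul_eq_nsmul ℝ]
          abel
        -- AM–GM with weight `a`, a bound for the root mean square, takes the place of
        -- Cauchy–Schwarz for the integral.
        have h4 : ‖∑ i, (t (x i) - E)‖
            ≤ (2 * a)⁻¹ * ‖∑ i, (t (x i) - E)‖ ^ 2 + a / 2 := by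
          set w := ‖∑ i, (t (x i) - E)‖
          have : (2 * a)⁻¹ * w ^ 2 + a / 2 - w = (2 * a)⁻¹ * (w - a) ^ 2 := by
            field_simp
            ring
          have h5 : 0 ≤ (2 * a)⁻¹ * (w - a) ^ 2 := by positivity
          linarith
        have h6 := norm_add_le (∑ i, (t (x i) - E)) ((m : ℝ) • (E - c))
        rw [norm_smul, Real.norm_of_nonneg (by positivity : (0 : ℝ) ≤ m)] at h6
        simp only [e]
        linarith
    _ = (2 * a)⁻¹ * (∫ x, ‖∑ i, (t (x i) - E)‖ ^ 2 ∂(Measure.pi fun _ : Fin m => μ))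
          + (a / 2 + m * ‖E - c‖) := by
        rw [integral_add (hI1.const_mul _) (integrable_const _), integral_const_mul]
        simp
    _ ≤ (2 * a)⁻¹ * a ^ 2 + (a / 2 + m * ‖E - c‖) := by
        rw [ha2]
        gcongr
    _ = a + m * ‖E - c‖ := by
        field_simp
        ring

/-- Exponential moment of the error of the batch mean as an estimate of `c`. -/
lemma integral_exp_norm_batchMean_sub_le (μ : Measure X) [IsProbabilityMeasure μ] (hR : 0 < R)
    (ht : Measurable t) (htR : ∀ x, ‖t x‖ ≤ R) {m : ℕ} (hm : 0 < m) (c : Param n) {s b : ℝ}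
    (hs : 0 ≤ s) (hb : ‖∫ x, t x ∂μ - c‖ ≤ b) :
    ∫ x, Real.exp (s * ‖(m : ℝ)⁻¹ • ∑ i, t (x i) - c‖) ∂(Measure.pi fun _ : Fin m => μ)
      ≤ Real.exp (s * (R / √m + b) + s ^ 2 * R ^ 2 / (2 * m)) := by
  have hm' : (0 : ℝ) < m := by positivity
  have h1 := integral_exp_lipschitz_sum_le μ hR.le ht htR (s / m) m
    (fun w => ‖w - (m : ℝ) • c‖) (LipschitzWith.of_dist_le_mul fun w w' => by
      rw [NNReal.coe_one, one_mul, Real.dist_eq, dist_eq_norm]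
      simpa using abs_norm_sub_norm_le (w - (m : ℝ) • c) (w' - (m : ℝ) • c))
  have e : ∀ x : Fin m → X, s * ‖(m : ℝ)⁻¹ • ∑ i, t (x i) - c‖
      = s / m * ‖∑ i, t (x i) - (m : ℝ) • c‖ := fun x => by
    rw [← Real.norm_of_nonneg (inv_nonneg.2 hm'.le), div_eq_mul_inv,
      ← Real.norm_of_nonneg (inv_nonneg.2 hm'.le), mul_assoc, ← norm_smul, smul_sub,
      inv_smul_smul₀ hm'.ne']
    simp
  simp only [e]
  refine h1.trans (Real.exp_le_exp.2 ?_)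
  have h2 := integral_norm_sum_sub_le μ hR ht htR hm c
  have h3 : R * √m + m * ‖∫ x, t x ∂μ - c‖ ≤ m * (R / √m + b) := by
    rw [mul_add, mul_div_left_comm, Real.div_sqrt]
    gcongr
  calc _ ≤ s / m * (m * (R / √m + b)) + m * R ^ 2 * (s / m) ^ 2 / 2 := by
        gcongr
        exact h2.trans h3
    _ = _ := by
        field_simp

end BatchConcentration

/-! ### Measurability of the chain law and of batches -/

section ChainLaw

variable {n : ℕ} {X : Type*} [MeasurableSpace X] {κ : Kernel (Param n × X) X}

lemma chainLaw_succ (θ : Param n) (v : ℕ) (q : Measure X) :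
    chainLaw κ θ (v + 1) q = (chainLaw κ θ v q).bind fun x => κ (θ, x) := by
  simp only [chainLaw, Function.iterate_succ', Function.comp_apply]

variable [IsMarkovKernel κ] (r : Measure X) [IsProbabilityMeasure r]

instance isProbabilityMeasure_chainLaw (θ : Param n) (v : ℕ) :
    IsProbabilityMeasure (chainLaw κ θ v r) := by
  induction v with
  | zero => simpa [chainLaw]
  | succ v ih =>
    rw [chainLaw_succ]
    have hm : Measurable fun x => κ (θ, x) := κ.measurable.comp measurable_prodMk_left
    refine ⟨?_⟩
    rw [Measure.bind_apply .univ hm.aemeasurable]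
    simp

/-- The algorithm runs the chain at a random parameter; this is where joint measurability of `κ` in
parameter and state is used. -/
lemma measurable_chainLaw (v : ℕ) : Measurable fun θ => chainLaw κ θ v r := by
  induction v with
  | zero => simpa only [chainLaw, Function.iterate_zero, id] using measurable_const
  | succ v ih =>
    let η : Kernel (Param n) X := ⟨fun θ => chainLaw κ θ v r, ih⟩
    have : IsMarkovKernel η := ⟨fun θ => isProbabilityMeasure_chainLaw r θ v⟩
    refine Measure.measurable_of_measurable_coe _ fun s hs => ?_
    have e : ∀ θ, chainLaw κ θ (v + 1) r s = ∫⁻ x, κ (θ, x) s ∂(η θ) := fun θ => by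
      have hm : Measurable fun x => κ (θ, x) := κ.measurable.comp measurable_prodMk_left
      rw [chainLaw_succ, Measure.bind_apply hs hm.aemeasurable]
      rfl
    simp only [e]
    exact Measurable.lintegral_kernel_prod_right (κ := η) (f := fun θ x => κ (θ, x) s)
      (κ.measurable_coe hs)

end ChainLaw

lemma measurable_pi_const {Ω X ι : Type*} [MeasurableSpace Ω] [MeasurableSpace X] [Fintype ι]
    {μ : Ω → Measure X} [∀ ω, IsProbabilityMeasure (μ ω)] (hμ : Measurable μ) :
    Measurable fun ω => Measure.pi fun _ : ι => μ ω := by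
  refine Measurable.measure_of_isPiSystem_of_isProbabilityMeasure generateFrom_pi.symm
    isPiSystem_pi ?_
  rintro _ ⟨s, hs, rfl⟩
  simp only [Measure.pi_pi]
  refine Finset.measurable_prod _ fun i _ => ?_
  exact (Measure.measurable_coe (hs i (Set.mem_univ i))).comp hμ

lemma measurable_snoc {k : ℕ} {Y : Type*} [MeasurableSpace Y] :
    Measurable fun p : (Fin k → Y) × Y => (Fin.snoc (α := fun _ => Y) p.1 p.2 : Fin (k + 1) → Y) := by
  refine measurable_pi_lambda _ fun i => ?_
  induction i using Fin.lastCases with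
  | last => simpa only [Fin.snoc_last] using measurable_snd
  | cast i =>
    simp only [Fin.snoc_castSucc]
    exact (measurable_pi_apply i).comp measurable_fst

/-- Only the starting point can lie outside `Θ`, so mixing is needed on `insert θ₀ Θ` and nowhere
else. -/
lemma iterate_mem_insert {n N M : ℕ} {X : Type*} {t : X → Param n} {z : Fin N → X} {lam L : ℝ}
    {Θ : Set (Param n)} (hne : Θ.Nonempty) (hc : IsClosed Θ) (θ₀ : Param n) (k : ℕ)
    (ω : Fin k → Fin M → X) : iterate t z lam L Θ θ₀ k ω ∈ insert θ₀ Θ := by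
  cases k with
  | zero => exact Set.mem_insert _ _
  | succ k => exact Set.mem_insert_of_mem _ (proj_spec hne hc _).1

/-! ### Law of the whole run and tail of the total error -/

section SampleLaw

variable {n N M : ℕ} {X : Type*} [MeasurableSpace X] {κ : Kernel (Param n × X) X}
  {ν : Measure X} {t : X → Param n} {z : Fin N → X} {lam L R : ℝ} {Θ : Set (Param n)}

lemma measurable_init {k : ℕ} {Y : Type*} [MeasurableSpace Y] :
    Measurable fun ω : Fin (k + 1) → Y => (Fin.init ω : Fin k → Y) :=
  measurable_pi_lambda _ fun i => measurable_pi_apply i.castSucc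

lemma measurable_iterate (ht : Measurable t) (hne : Θ.Nonempty) (hc : IsClosed Θ)
    (hconv : Convex ℝ Θ) (θ₀ : Param n) (k : ℕ) :
    Measurable (iterate (M := M) t z lam L Θ θ₀ k) := by
  induction k with
  | zero => exact measurable_const
  | succ k ih =>
    have h1 : Measurable fun ω : Fin (k + 1) → Fin M → X =>
        iterate t z lam L Θ θ₀ k (Fin.init ω) := ih.comp measurable_init
    have h2 : Measurable fun ω : Fin (k + 1) → Fin M → X =>
        gradEstimate t z lam (iterate t z lam L Θ θ₀ k (Fin.init ω)) (ω (Fin.last k)) := by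
      unfold gradEstimate
      fun_prop
    exact (lipschitzWith_proj hne hc hconv).continuous.measurable.comp
      (h1.sub (h2.const_smul L⁻¹))

lemma measurable_integral_expFamily [IsFiniteMeasure ν] [NeZero ν] (ht : Measurable t)
    (htR : ∀ x, ‖t x‖ ≤ R) : Measurable fun θ => ∫ x, t x ∂(expFamily ν t θ) := by
  simp only [expFamily_eq_tilted ht htR, integral_tilted]
  have h1 : Measurable fun p : Param n × X => Real.exp (inner ℝ p.1 (t p.2)) := by fun_prop
  have h2 : Measurable fun θ : Param n => ∫ x, Real.exp (inner ℝ θ (t x)) ∂ν :=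
    (StronglyMeasurable.integral_prod_right' h1.stronglyMeasurable).measurable
  have h3 : Measurable fun p : Param n × X =>
      (Real.exp (inner ℝ p.1 (t p.2)) / ∫ x, Real.exp (inner ℝ p.1 (t x)) ∂ν) • t p.2 :=
    (h1.div (h2.comp measurable_fst)).smul (ht.comp measurable_snd)
  exact (StronglyMeasurable.integral_prod_right' h3.stronglyMeasurable).measurable

lemma measurable_errorSum [IsFiniteMeasure ν] [NeZero ν] (ht : Measurable t)
    (htR : ∀ x, ‖t x‖ ≤ R) (hne : Θ.Nonempty) (hc : IsClosed Θ) (hconv : Convex ℝ Θ)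
    (θ₀ : Param n) (k : ℕ) : Measurable (errorSum (M := M) ν t z lam L Θ θ₀ k) := by
  induction k with
  | zero => exact measurable_const
  | succ k ih =>
    have h1 : Measurable fun ω : Fin (k + 1) → Fin M → X =>
        ∫ x, t x ∂(expFamily ν t (iterate t z lam L Θ θ₀ k (Fin.init ω))) :=
      (measurable_integral_expFamily ht htR).comp
        ((measurable_iterate ht hne hc hconv θ₀ k).comp measurable_init)
    have h2 : Measurable fun ω : Fin (k + 1) → Fin M → X =>
        gradError ν t (iterate t z lam L Θ θ₀ k (Fin.init ω)) (ω (Fin.last k)) := by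
      unfold gradError
      fun_prop
    exact (ih.comp measurable_init).add h2.norm

/-- The one-batch bound is uniform over the past, so each iteration contributes one constant factor.
Upper bounds for integrals against `bind` and `map` suffice, and these need no measurability. -/
lemma lintegral_exp_errorSum_le (r : Measure X) (hne : Θ.Nonempty) (hc : IsClosed Θ) (θ₀ : Param n) (v : ℕ)
    {s c : ℝ} (hstep : ∀ θ ∈ insert θ₀ Θ,
      ∫⁻ x, ENNReal.ofReal (Real.exp (s * ‖gradError ν t θ x‖))
        ∂(Measure.pi fun _ : Fin M => chainLaw κ θ v r) ≤ ENNReal.ofReal (Real.exp c)) (k : ℕ) :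
    ∫⁻ ω, ENNReal.ofReal (Real.exp (s * errorSum ν t z lam L Θ θ₀ k ω))
        ∂(sampleLaw κ r t z lam L Θ θ₀ M v k) ≤ ENNReal.ofReal (Real.exp (k * c)) := by
  induction k with
  | zero => simp [sampleLaw, errorSum]
  | succ k ih =>
    rw [sampleLaw]
    refine (Measure.lintegral_bind_le _ _ _).trans ?_
    calc _ ≤ ∫⁻ ω, ENNReal.ofReal (Real.exp (s * errorSum ν t z lam L Θ θ₀ k ω))
            * ENNReal.ofReal (Real.exp c) ∂(sampleLaw κ r t z lam L Θ θ₀ M v k) := by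
          refine lintegral_mono fun ω => (lintegral_map_le _ _).trans ?_
          simp only [errorSum, Fin.init_snoc, Fin.snoc_last, mul_add, Real.exp_add,
            ENNReal.ofReal_mul (Real.exp_pos _).le]
          rw [lintegral_const_mul' _ _ ENNReal.ofReal_ne_top]
          gcongr
          exact hstep _ (iterate_mem_insert hne hc θ₀ k ω)
      _ ≤ _ := by
          rw [lintegral_mul_const' _ _ ENNReal.ofReal_ne_top]
          refine (mul_le_mul_left ih _).trans (le_of_eq ?_)
          rw [← ENNReal.ofReal_mul (Real.exp_pos _).le, ← Real.exp_add]
          push_cast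
          ring_nf

variable [IsMarkovKernel κ] (r : Measure X) [IsProbabilityMeasure r]

/-- This makes the `bind` in `sampleLaw` a genuine composition, so the total mass stays one. -/
lemma measurable_batchLaw (ht : Measurable t) (hne : Θ.Nonempty) (hc : IsClosed Θ)
    (hconv : Convex ℝ Θ) (θ₀ : Param n) (v k : ℕ) :
    Measurable fun ω : Fin k → Fin M → X =>
      (Measure.pi fun _ : Fin M => chainLaw κ (iterate t z lam L Θ θ₀ k ω) v r).map
        fun x => (Fin.snoc (α := fun _ => Fin M → X) ω x : Fin (k + 1) → Fin M → X) := by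
  let η : Kernel (Fin k → Fin M → X) (Fin M → X) :=
    ⟨fun ω => Measure.pi fun _ : Fin M => chainLaw κ (iterate t z lam L Θ θ₀ k ω) v r,
      measurable_pi_const
        ((measurable_chainLaw r v).comp (measurable_iterate ht hne hc hconv θ₀ k))⟩
  have : IsMarkovKernel η := ⟨fun ω => by change IsProbabilityMeasure (Measure.pi _); infer_instance⟩
  refine Measure.measurable_of_measurable_coe _ fun s hs => ?_
  have e := fun ω : Fin k → Fin M → X =>
    Measure.map_apply (μ := η ω) (measurable_snoc.comp (measurable_prodMk_left (x := ω))) hs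
  have h := Kernel.measurable_kernel_prodMk_left (κ := η) (measurable_snoc hs)
  exact (funext e ▸ h :)

lemma isProbabilityMeasure_sampleLaw (ht : Measurable t) (hne : Θ.Nonempty) (hc : IsClosed Θ)
    (hconv : Convex ℝ Θ) (θ₀ : Param n) (v k : ℕ) :
    IsProbabilityMeasure (sampleLaw κ r t z lam L Θ θ₀ M v k) := by
  induction k with
  | zero =>
    rw [sampleLaw]
    infer_instance
  | succ k ih =>
    rw [sampleLaw]
    refine ⟨?_⟩
    rw [Measure.bind_apply .univ (measurable_batchLaw r ht hne hc hconv θ₀ v k).aemeasurable]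
    have : ∀ ω : Fin k → Fin M → X, ((Measure.pi fun _ : Fin M =>
        chainLaw κ (iterate t z lam L Θ θ₀ k ω) v r).map
        fun x => (Fin.snoc (α := fun _ => Fin M → X) ω x : Fin (k + 1) → Fin M → X)) .univ = 1 :=
      fun ω => by
        have hm : Measurable fun x : Fin M → X =>
            (Fin.snoc (α := fun _ => Fin M → X) ω x : Fin (k + 1) → Fin M → X) :=
          measurable_snoc.comp measurable_prodMk_left
        rw [Measure.map_apply hm .univ]
        simp
    simp [this]

variable [IsFiniteMeasure ν] [NeZero ν]

lemma lintegral_exp_gradError_le (hR : 0 < R) (ht : Measurable t) (htR : ∀ x, ‖t x‖ ≤ R)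
    (hM : 0 < M) (θ : Param n) (q : Measure X) [IsProbabilityMeasure q] {s τ : ℝ} (hs : 0 ≤ s)
    (hτ : tvDist q (expFamily ν t θ) ≤ τ) :
    ∫⁻ x, ENNReal.ofReal (Real.exp (s * ‖gradError ν t θ x‖)) ∂(Measure.pi fun _ : Fin M => q)
      ≤ ENNReal.ofReal (Real.exp (s * (R / √M + 2 * R * τ) + s ^ 2 * R ^ 2 / (2 * M))) := by
  have := isProbabilityMeasure_expFamily (ν := ν) ht htR θ
  have hint : Integrable (fun x => Real.exp (s * ‖gradError ν t θ x‖))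
      (Measure.pi fun _ : Fin M => q) :=
    integrable_comp_sum _ ht htR (G := fun w => Real.exp (s * ‖(M : ℝ)⁻¹ • w -
      ∫ y, t y ∂(expFamily ν t θ)‖)) (by fun_prop)
  rw [← ofReal_integral_eq_lintegral_ofReal hint (.of_forall fun x => (Real.exp_pos _).le)]
  refine ENNReal.ofReal_le_ofReal
    (integral_exp_norm_batchMean_sub_le q hR ht htR hM _ hs ?_)
  refine (norm_integral_sub_le_tvDist q _ hR.le ht htR).trans ?_
  gcongr

/-- With probability at least `1 - δ` the total gradient error exceeds its expectation by at most a
deviation of order `√(K log (1/δ) / M)`. -/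
theorem one_sub_le_measure_errorSum_lt (hR : 0 < R) (ht : Measurable t) (htR : ∀ x, ‖t x‖ ≤ R)
    (hne : Θ.Nonempty) (hc : IsClosed Θ) (hconv : Convex ℝ Θ) (θ₀ : Param n) {K v : ℕ}
    (hK : 0 < K) (hM : 0 < M) {δ τ : ℝ} (hδ0 : 0 < δ) (hδ1 : δ < 1)
    (hmix : ∀ θ ∈ insert θ₀ Θ, tvDist (chainLaw κ θ v r) (expFamily ν t θ) ≤ τ) :
    1 - δ ≤ (sampleLaw κ r t z lam L Θ θ₀ M v K).real
      {ω | errorSum ν t z lam L Θ θ₀ K ω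
        < K * (R / √M + 2 * R * τ) + R * √(2 * K * Real.log (1 / δ) / M)} := by
  set μ := sampleLaw κ r t z lam L Θ θ₀ M v K
  have : IsProbabilityMeasure μ := isProbabilityMeasure_sampleLaw r ht hne hc hconv θ₀ v K
  set l := Real.log (1 / δ) with hl
  have hl0 : 0 < l := Real.log_pos (by rw [lt_div_iff₀ hδ0]; linarith)
  have hK' : (0 : ℝ) < K := by positivity
  have hM' : (0 : ℝ) < M := by positivity
  set m := R / √M + 2 * R * τ
  set w := √(2 * K * l / M) with hw
  have hw0 : 0 < w := Real.sqrt_pos.2 (by positivity)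
  have hw2 : w ^ 2 = 2 * K * l / M := Real.sq_sqrt (by positivity)
  set a := K * m + R * w
  -- The Chernoff parameter minimizing `K s² R² / (2M) - s R w`. There `s R w = 2l` and the
  -- quadratic term equals `l`, so the tail is `exp (-l) = δ`.
  set s := M * w / (K * R) with hs
  have hs0 : 0 < s := by positivity
  have hmeas : Measurable (errorSum (M := M) ν t z lam L Θ θ₀ K) :=
    measurable_errorSum ht htR hne hc hconv θ₀ K
  have h1 := lintegral_exp_errorSum_le (ν := ν) (z := z) (lam := lam) (L := L) (κ := κ) r hne hc θ₀
    v (fun θ hθ => lintegral_exp_gradError_le hR ht htR hM θ (chainLaw κ θ v r) hs0.le (hmix θ hθ)) K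
  have h2 := mul_meas_ge_le_lintegral (μ := μ)
    (f := fun ω => ENNReal.ofReal (Real.exp (s * errorSum ν t z lam L Θ θ₀ K ω)))
    (by fun_prop) (ENNReal.ofReal (Real.exp (s * a)))
  have h3 : s * a = K * (s * m + s ^ 2 * R ^ 2 / (2 * M)) + l := by
    have e1 : s * (R * w) = 2 * l := by
      rw [hs, show M * w / (K * R) * (R * w) = M * w ^ 2 / K by field_simp, hw2]
      field_simp
    have e2 : K * (s ^ 2 * R ^ 2 / (2 * M)) = l := by
      rw [hs, show K * ((M * w / (K * R)) ^ 2 * R ^ 2 / (2 * M)) = M * w ^ 2 / (2 * K) by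
        field_simp, hw2]
      field_simp
    rw [show s * a = K * (s * m) + s * (R * w) by ring, e1, mul_add (K : ℝ) (s * m), e2]
    ring
  have hexp : Real.exp (-l) = δ := by
    rw [hl, one_div, Real.log_inv, neg_neg, Real.exp_log hδ0]
  have h4 : μ {ω : Fin K → Fin M → X | a ≤ errorSum ν t z lam L Θ θ₀ K ω} ≤ ENNReal.ofReal δ := by
    have hsub : {ω : Fin K → Fin M → X | a ≤ errorSum ν t z lam L Θ θ₀ K ω} ⊆
        {ω : Fin K → Fin M → X | ENNReal.ofReal (Real.exp (s * a))
          ≤ ENNReal.ofReal (Real.exp (s * errorSum ν t z lam L Θ θ₀ K ω))} := fun ω hω => by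
      have : a ≤ errorSum ν t z lam L Θ θ₀ K ω := hω
      simp only [Set.mem_ofPred_eq]
      gcongr
    refine (measure_mono hsub).trans ?_
    have hpos : ENNReal.ofReal (Real.exp (s * a)) ≠ 0 := by
      simpa using Real.exp_pos _
    refine (ENNReal.mul_le_mul_iff_right hpos ENNReal.ofReal_ne_top).1 ((h2.trans h1).trans ?_)
    rw [← hexp, ← ENNReal.ofReal_mul (Real.exp_pos _).le, ← Real.exp_add, h3]
    simp [m]
  have h5 : μ.real {ω : Fin K → Fin M → X | a ≤ errorSum ν t z lam L Θ θ₀ K ω} ≤ δ :=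
    ENNReal.toReal_le_of_le_ofReal hδ0.le h4
  have h6 := probReal_compl_eq_one_sub (μ := μ) (measurableSet_le measurable_const hmeas (f := fun _ => a))
  have h7 : {ω : Fin K → Fin M → X | a ≤ errorSum ν t z lam L Θ θ₀ K ω}ᶜ
      = {ω : Fin K → Fin M → X | errorSum ν t z lam L Θ θ₀ K ω < a} := by
    ext ω
    simp
  rw [h7] at h6
  linarith

end SampleLaw

/-! ### Arithmetic of the rounded schedule -/

section Schedule

/-- The constant lies just above `e/2`. The inequality `y exp (1 - y) ≤ 1` at `y = α` reduces to
exponent one, and at `y = 2α` it bounds `α exp (2(1 - α))` by `e/2`. -/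
lemma pow_floor_mul_exp_le {α c : ℝ} (hα0 : 0 < α) (hα1 : α < 1) (hc : 1 ≤ c) :
    α ^ ⌊c⌋₊ * Real.exp ((1 - α) * c) ≤ 1.36 := by
  set v := ⌊c⌋₊
  have hv : 1 ≤ v := Nat.le_floor (by exact_mod_cast hc)
  have hcv : c ≤ v + 1 := (Nat.lt_floor_add_one c).le
  have key : ∀ y : ℝ, y * Real.exp (1 - y) ≤ 1 := fun y => by
    have h := Real.add_one_le_exp (y - 1)
    calc y * Real.exp (1 - y) ≤ Real.exp (y - 1) * Real.exp (1 - y) := by gcongr; linarith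
      _ = 1 := by rw [← Real.exp_add]; simp
  have h0 : 0 ≤ α * Real.exp (1 - α) := by positivity
  have h1 : (α * Real.exp (1 - α)) ^ v ≤ α * Real.exp (1 - α) := by
    simpa using pow_le_pow_of_le_one h0 (key α) hv
  have h2 : 2 * α * Real.exp (1 - 2 * α) ≤ 1 := key (2 * α)
  calc α ^ v * Real.exp ((1 - α) * c) ≤ α ^ v * Real.exp ((1 - α) * (v + 1)) := by
        gcongr
    _ = (α * Real.exp (1 - α)) ^ v * Real.exp (1 - α) := by
        rw [mul_pow, ← Real.exp_nat_mul, mul_assoc, ← Real.exp_add]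
        ring_nf
    _ ≤ α * Real.exp (1 - α) * Real.exp (1 - α) := by gcongr
    _ = 2 * α * Real.exp (1 - 2 * α) * (Real.exp 1 / 2) := by
        rw [mul_assoc α, ← Real.exp_add, show 1 - α + (1 - α) = (1 - 2 * α) + 1 by ring,
          Real.exp_add]
        ring
    _ ≤ 1 * (2.7182818286 / 2) := by
        gcongr
        exact Real.exp_one_lt_d9.le
    _ ≤ 1.36 := by norm_num

lemma le_two_mul_floor {a : ℝ} (ha : 1 ≤ a) : a ≤ 2 * ⌊a⌋₊ := by
  have h1 : (1 : ℝ) ≤ ⌊a⌋₊ := by exact_mod_cast Nat.le_floor (by exact_mod_cast ha)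
  linarith [Nat.lt_floor_add_one a]

/-- In the application `σ²` is the fraction of the real iteration count that survives rounding.
Since `1 ≤ √2 σ` and `1.4143` exceeds `√2`, every term is at most `σ²` times a polynomial in `β`. -/
lemma scaled_error_le {σ β Y : ℝ} (hσ0 : 0 < σ) (hσ : 1 / 2 ≤ σ ^ 2) (hβ0 : 0 < β) (hβ1 : β ≤ 1)
    (hY0 : 0 ≤ Y) (hY : Y ≤ σ * (1.36 - 1.0626 * β)) :
    β ^ 2 / 4 + β * Y / 2 + Y ^ 2 / 2 ≤ σ ^ 2 := by
  set W := 1.36 - 1.0626 * β with hW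
  have hσβ : β ≤ 1.4143 * σ * β := by
    have : 1 ≤ 1.4143 * σ := by
      refine le_of_sq_le_sq ?_ (by positivity)
      rw [mul_pow]
      linarith
    exact le_mul_of_one_le_left hβ0.le this
  have e1 : β ^ 2 / 4 ≤ σ ^ 2 * (β ^ 2 / 2) := by
    have := mul_le_mul_of_nonneg_right hσ (sq_nonneg β)
    linarith
  have e2 : β * Y / 2 ≤ σ ^ 2 * (0.70715 * β * W) := by
    calc β * Y / 2 ≤ (1.4143 * σ * β) * (σ * W) / 2 := by gcongr
      _ = _ := by ring
  have e3 : Y ^ 2 / 2 ≤ σ ^ 2 * (W ^ 2 / 2) := by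
    calc Y ^ 2 / 2 ≤ (σ * W) ^ 2 / 2 := by gcongr
      _ = _ := by ring
  have e4 : β ^ 2 / 2 + 0.70715 * β * W + W ^ 2 / 2 ≤ 1 := by
    rw [hW]
    -- A convex quadratic in `β` that is below one at both ends of `[0, 1]`.
    nlinarith [mul_nonneg hβ0.le (sub_nonneg.2 hβ1)]
  have e5 := mul_le_mul_of_nonneg_left e4 (sq_nonneg σ)
  linarith

variable {R L C α D β₁ β₂ β₃ ε l : ℝ}

/-- The optimization bound and the concentration bound combine to the accuracy `ε` when the three
parameters are the integer parts of the prescribed real numbers. -/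
theorem schedule_bound (hR : 0 < R) (hL : 0 < L) (hC : 0 < C) (hα0 : 0 < α) (hα1 : α < 1)
    (hD : 0 < D) (hβ₁ : 0 < β₁) (hβ₂ : 0 < β₂) (hβ₃ : 0 < β₃) (hβ : β₁ + β₂ + β₃ = 1)
    (hε : 0 < ε) (hl0 : 0 ≤ l) (hl : 4 * R / L * l ≤ D)
    (ha : 1 ≤ 2 * L * D ^ 2 / (β₁ ^ 2 * ε)) (hb : 1 ≤ (4 * D * R / (β₁ * β₂ * ε)) ^ 2)
    (hc : 1 ≤ Real.log (4 * D * R * C / (β₁ * β₃ * ε)) / (1 - α)) {K M v : ℕ}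
    (hK : K = ⌊2 * L * D ^ 2 / (β₁ ^ 2 * ε)⌋₊) (hM : M = ⌊(4 * D * R / (β₁ * β₂ * ε)) ^ 2⌋₊)
    (hv : v = ⌊Real.log (4 * D * R * C / (β₁ * β₃ * ε)) / (1 - α)⌋₊) {S : ℝ}
    (hS : S = K * (R / √M + 2 * R * (C * α ^ v)) + R * √(2 * K * l / M)) :
    (K : ℝ)⁻¹ * (L / 2 * D ^ 2 + S * D + S ^ 2 / L) ≤ ε := by
  set a := 2 * L * D ^ 2 / (β₁ ^ 2 * ε) with ha_def
  set B := 4 * D * R / (β₁ * β₂ * ε) with hB_def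
  set c := Real.log (4 * D * R * C / (β₁ * β₃ * ε)) / (1 - α) with hc_def
  have hB0 : 0 < B := by positivity
  have ha0 : 0 < a := by positivity
  have hK1 : (1 : ℝ) ≤ K := by
    rw [hK]; exact_mod_cast Nat.le_floor (by exact_mod_cast ha)
  have hM1 : (1 : ℝ) ≤ M := by
    rw [hM]; exact_mod_cast Nat.le_floor (by exact_mod_cast hb)
  have hKa : (K : ℝ) ≤ a := by rw [hK]; exact Nat.floor_le ha0.le
  have haK : a ≤ 2 * K := by rw [hK]; exact le_two_mul_floor ha
  have hBM : B ^ 2 ≤ 2 * M := by rw [hM]; exact le_two_mul_floor hb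
  have hLD : L * D ^ 2 = β₁ ^ 2 * ε * a / 2 := by rw [ha_def]; field_simp
  have hDR : D * R = β₁ * β₂ * ε * B / 4 := by rw [hB_def]; field_simp
  have hRLD : R / (L * D) = β₂ * B / (2 * β₁ * a) := by
    rw [div_eq_div_iff (by positivity) (by positivity)]
    have : (R * (2 * β₁ * a)) * D = (β₂ * B * (L * D)) * D := by
      calc (R * (2 * β₁ * a)) * D = (D * R) * (2 * β₁ * a) := by ring
        _ = β₂ * B * (L * D ^ 2) := by rw [hDR, hLD]; ring
        _ = _ := by ring
    exact mul_right_cancel₀ hD.ne' this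
  set σ := √(K / a) with hσ
  have hσ2 : σ ^ 2 = K / a := Real.sq_sqrt (by positivity)
  have hσ0 : 0 < σ := Real.sqrt_pos.2 (by positivity)
  have hσ1 : σ ≤ 1 := by
    rw [hσ, Real.sqrt_le_one, div_le_one ha0]; exact hKa
  have hσ3 : 1 / 2 ≤ σ ^ 2 := by
    rw [hσ2, le_div_iff₀ ha0]; linarith
  -- the three contributions to the error, in units of `L * D / β₁`
  set Y₁ := β₁ * (K * (R / √M)) / (L * D) with hY₁
  set Y₂ := β₁ * (K * (2 * R * (C * α ^ v))) / (L * D) with hY₂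
  set Y₃ := β₁ * (R * √(2 * K * l / M)) / (L * D) with hY₃
  have hY : β₁ * S = L * D * (Y₁ + Y₂ + Y₃) := by
    rw [hS, hY₁, hY₂, hY₃]; field_simp
  have h1 : Y₁ ≤ σ ^ 2 * (0.7072 * β₂) := by
    have e : Y₁ = σ ^ 2 * (β₂ * (B / √M) / 2) := by
      rw [hσ2, hY₁, show β₁ * (K * (R / √M)) / (L * D) = β₁ * K / √M * (R / (L * D)) by ring, hRLD]
      field_simp
    have hg : B / √M ≤ 1.4144 := by
      rw [div_le_iff₀ (by positivity)]
      refine le_of_sq_le_sq ?_ (by positivity)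
      rw [mul_pow, Real.sq_sqrt (by positivity)]
      linarith
    have hg' := mul_le_mul_of_nonneg_left hg hβ₂.le
    rw [e]
    gcongr
    linarith
  have h2 : Y₂ ≤ σ ^ 2 * (1.36 * β₃) := by
    have hexp : Real.exp ((1 - α) * c) = 4 * D * R * C / (β₁ * β₃ * ε) := by
      rw [hc_def, mul_div_cancel₀ _ (by linarith), Real.exp_log (by positivity)]
    have hp := pow_floor_mul_exp_le hα0 hα1 hc
    rw [hexp, ← hv, ← mul_div_assoc, div_le_iff₀ (by positivity)] at hp
    rw [hσ2, hY₂, div_mul_eq_mul_div, div_le_div_iff₀ (by positivity) ha0]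
    have : β₁ * (K * (2 * R * (C * α ^ v))) * a * D ≤ K * (1.36 * β₃) * (L * D) * D := by
      calc _ = β₁ * K * a / 2 * (α ^ v * (4 * D * R * C)) := by ring
        _ ≤ β₁ * K * a / 2 * (1.36 * (β₁ * β₃ * ε)) := by gcongr
        _ = K * (1.36 * β₃) * (β₁ ^ 2 * ε * a / 2) := by ring
        _ = _ := by rw [← hLD]; ring
    exact le_of_mul_le_mul_right this hD
  have h3 : Y₃ ≤ σ * (0.2974 * (β₁ + β₂)) := by
    -- The lower bound on `D` trades `R l` for `L D / 4`, and `B² ≤ 2M ≤ 2M²` removes `B / M`. The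
    -- constant satisfies `0.2974² ≥ 1.4143 / 16`, as AM–GM for `β₁ β₂` requires.
    refine le_of_sq_le_sq ?_ (by positivity)
    have hBM' : B ≤ 1.4143 * M := by
      have hM2 : (M : ℝ) ≤ M ^ 2 := le_self_pow₀ hM1 two_ne_zero
      refine le_of_sq_le_sq ?_ (by positivity)
      rw [mul_pow]
      linarith
    have hl' : R * l ≤ L * D / 4 := by
      rw [div_mul_eq_mul_div, div_le_iff₀ hL] at hl
      linarith
    calc Y₃ ^ 2 = β₁ ^ 2 * R ^ 2 * (2 * K * l / M) / (L * D) ^ 2 := by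
          rw [hY₃, div_pow, mul_pow, mul_pow, Real.sq_sqrt (by positivity)]
          ring
      _ = 2 * β₁ ^ 2 * K / M / (L * D) * (R / (L * D)) * (R * l) := by field_simp
      _ ≤ 2 * β₁ ^ 2 * K / M / (L * D) * (R / (L * D)) * (L * D / 4) := by gcongr
      _ = σ ^ 2 * (β₁ * β₂ * (B / M) / 4) := by
          rw [hRLD, hσ2]; field_simp
      _ ≤ σ ^ 2 * (β₁ * β₂ * 1.4143 / 4) := by
          gcongr
          rw [div_le_iff₀ (by positivity)]
          exact hBM'
      _ ≤ σ ^ 2 * (0.2974 * (β₁ + β₂)) ^ 2 := by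
          gcongr
          have e1 := sq_nonneg (β₁ - β₂)
          have e2 := mul_pos hβ₁ hβ₂
          rw [mul_pow]
          ring_nf at e1 e2 ⊢
          linarith
      _ = _ := by ring
  set Y := Y₁ + Y₂ + Y₃ with hYdef
  have hY0 : 0 ≤ Y := by positivity
  have hYW : Y ≤ σ * (1.36 - 1.0626 * β₁) := by
    have hσσ : σ ^ 2 ≤ σ := pow_le_of_le_one hσ0.le hσ1 two_ne_zero
    have h4 : σ ^ 2 * (0.7072 * β₂) ≤ σ * (0.7072 * β₂) := by gcongr
    have h5 : σ ^ 2 * (1.36 * β₃) ≤ σ * (1.36 * β₃) := by gcongr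
    -- Here `1.0626 = 1.36 - 0.2974` and the weights sum to one; what remains is `0.7072 + 0.2974 ≤
    -- 1.36`.
    have h6 : σ * (0.7072 * β₂ + 1.36 * β₃ + 0.2974 * (β₁ + β₂)) ≤ σ * (1.36 - 1.0626 * β₁) := by
      gcongr
      linarith
    linarith
  have hS' : S = L * D * Y / β₁ := by
    rw [eq_div_iff hβ₁.ne', mul_comm S, hY]
  have hmain := scaled_error_le hσ0 hσ3 hβ₁ (by linarith) hY0 hYW
  calc (K : ℝ)⁻¹ * (L / 2 * D ^ 2 + S * D + S ^ 2 / L)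
      = (K : ℝ)⁻¹ * ((L * D ^ 2) * (1 / 2 + Y / β₁ + Y ^ 2 / β₁ ^ 2)) := by
        rw [hS']; field_simp
    _ = ε * (a / K) * (β₁ ^ 2 / 4 + β₁ * Y / 2 + Y ^ 2 / 2) := by
        rw [hLD]; field_simp; ring
    _ ≤ ε * (a / K) * σ ^ 2 := by gcongr
    _ = ε := by rw [hσ2]; field_simp

lemma exists_le_schedule_ge_one (hR : 0 < R) (hL : 0 < L) (hC : 0 < C) (hα0 : 0 < α)
    (hα1 : α < 1) (hD : 0 < D) (hβ₁ : 0 < β₁) (hβ₂ : 0 < β₂) (hβ₃ : 0 < β₃) (hε : 0 < ε) :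
    ∃ ε', 0 < ε' ∧ ε' ≤ ε ∧ 1 ≤ 2 * L * D ^ 2 / (β₁ ^ 2 * ε') ∧
      1 ≤ (4 * D * R / (β₁ * β₂ * ε')) ^ 2 ∧
      1 ≤ Real.log (4 * D * R * C / (β₁ * β₃ * ε')) / (1 - α) := by
  set x₁ := 2 * L * D ^ 2 / β₁ ^ 2 with hx₁
  set x₂ := 4 * D * R / (β₁ * β₂) with hx₂
  set x₃ := 4 * D * R * C / (β₁ * β₃) with hx₃
  have hp₁ : 0 < x₁ := by positivity
  have hp₂ : 0 < x₂ := by positivity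
  have hp₃ : 0 < x₃ := by positivity
  -- The last entry makes the logarithm at least one, hence at least `1 - α`.
  set ε' := min (min ε x₁) (min x₂ (x₃ / Real.exp 1)) with hε'
  have h0 : 0 < ε' := by positivity
  refine ⟨ε', h0, (min_le_left _ _).trans (min_le_left _ _), ?_, ?_, ?_⟩
  · rw [← div_div, ← hx₁, one_le_div h0]
    exact (min_le_left _ _).trans (min_le_right _ _)
  · rw [← div_div, ← hx₂]
    refine one_le_pow₀ ?_
    rw [one_le_div h0]
    exact (min_le_right _ _).trans (min_le_left _ _)
  · rw [← div_div, ← hx₃, one_le_div (by linarith)]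
    refine le_trans (by linarith : 1 - α ≤ 1) ?_
    rw [Real.le_log_iff_exp_le (by positivity), le_div_iff₀ h0, mul_comm,
      ← le_div_iff₀ (Real.exp_pos 1)]
    exact (min_le_right _ _).trans (min_le_right _ _)

end Schedule

end

end MCMCLearning

/-! ### Assembly of the guarantee and the cost -/

theorem theorem5
    (R₂ lam L C α δ D β₁ β₂ β₃ ε_f : ℝ)
    (hR₂ : 0 < R₂) (hlam : 0 ≤ lam) (hL : L = 4 * R₂ ^ 2 + lam)
    (hC : 0 < C) (hα0 : 0 < α) (hα1 : α < 1) (hδ0 : 0 < δ) (hδ1 : δ < 1)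
    (hβ₁ : 0 < β₁) (hβ₂ : 0 < β₂) (hβ₃ : 0 < β₃) (hβ : β₁ + β₂ + β₃ = 1)
    (hε : 0 < ε_f)
    (hDδ : 4 * R₂ / L * Real.log (1 / δ) ≤ D) :
    ∃ K M v : ℕ, 0 < K ∧ 0 < M ∧ 0 < v ∧
      -- the guarantee, for every problem with these constants
      (∀ (n N : ℕ) (X : Type*) [MeasurableSpace X]
        (ν : Measure X) [IsFiniteMeasure ν] [NeZero ν]
        (t : X → MCMCLearning.Param n) (_ht : Measurable t) (_htR : ∀ x, ‖t x‖ ≤ R₂)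
        (_hN : 0 < N) (z : Fin N → X)
        (Θ : Set (MCMCLearning.Param n)) (_hΘclosed : IsClosed Θ) (_hΘconvex : Convex ℝ Θ)
        (κ : Kernel (MCMCLearning.Param n × X) X) [IsMarkovKernel κ]
        (r : Measure X) [IsProbabilityMeasure r]
        (θ₀ θstar : MCMCLearning.Param n)
        (_hmix : ∀ θ ∈ insert θ₀ Θ, ∀ q : Measure X, IsProbabilityMeasure q → ∀ w : ℕ,
          MCMCLearning.tvDist (MCMCLearning.chainLaw κ θ w q)
            (MCMCLearning.expFamily ν t θ) ≤ C * α ^ w)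
        (_hstar : θstar ∈ Θ) (_hmin : IsMinOn (MCMCLearning.objective ν t z lam) Θ θstar)
        (_hD : ‖θ₀ - θstar‖ ≤ D),
        1 - δ ≤ (MCMCLearning.sampleLaw κ r t z lam L Θ θ₀ M v K).real
          {ω | MCMCLearning.objective ν t z lam
                (MCMCLearning.averageIterate t z lam L Θ θ₀ ω)
              - MCMCLearning.objective ν t z lam θstar ≤ ε_f}) ∧
      -- the bound on the total number of Markov transitions, provided that the real numbers
      -- that the schedule prescribes for `K`, `M`, `v` are at least one
      (1 ≤ 2 * L * D ^ 2 / (β₁ ^ 2 * ε_f) →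
        1 ≤ (4 * D * R₂ / (β₁ * β₂ * ε_f)) ^ 2 →
        1 ≤ Real.log (4 * D * R₂ * C / (β₁ * β₃ * ε_f)) / (1 - α) →
        (K : ℝ) * M * v ≤
          32 * L * R₂ ^ 2 * D ^ 4 / (β₁ ^ 4 * β₂ ^ 2 * ε_f ^ 3 * (1 - α)) *
            Real.log (4 * D * R₂ * C / (β₁ * β₃ * ε_f))) := by
  subst hL
  set L := 4 * R₂ ^ 2 + lam with hL
  have hL0 : 0 < L := by positivity
  have hl : 0 < Real.log (1 / δ) := Real.log_pos (by rw [lt_div_iff₀ hδ0]; linarith)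
  have hD : 0 < D := lt_of_lt_of_le (by positivity) hDδ
  -- the schedule is run for the smaller accuracy `ε`, equal to `ε_f` when the latter is small
  obtain ⟨ε, hε0, hεle, ha, hb, hc, hcase⟩ : ∃ ε, 0 < ε ∧ ε ≤ ε_f ∧
      1 ≤ 2 * L * D ^ 2 / (β₁ ^ 2 * ε) ∧ 1 ≤ (4 * D * R₂ / (β₁ * β₂ * ε)) ^ 2 ∧
      1 ≤ Real.log (4 * D * R₂ * C / (β₁ * β₃ * ε)) / (1 - α) ∧
      (1 ≤ 2 * L * D ^ 2 / (β₁ ^ 2 * ε_f) → 1 ≤ (4 * D * R₂ / (β₁ * β₂ * ε_f)) ^ 2 →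
        1 ≤ Real.log (4 * D * R₂ * C / (β₁ * β₃ * ε_f)) / (1 - α) → ε = ε_f) := by
    by_cases h : 1 ≤ 2 * L * D ^ 2 / (β₁ ^ 2 * ε_f) ∧ 1 ≤ (4 * D * R₂ / (β₁ * β₂ * ε_f)) ^ 2 ∧
        1 ≤ Real.log (4 * D * R₂ * C / (β₁ * β₃ * ε_f)) / (1 - α)
    · exact ⟨ε_f, hε, le_rfl, h.1, h.2.1, h.2.2, fun _ _ _ => rfl⟩
    · obtain ⟨ε, h1, h2, h3, h4, h5⟩ := MCMCLearning.exists_le_schedule_ge_one (ε := ε_f) hR₂ hL0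
        hC hα0 hα1 hD hβ₁ hβ₂ hβ₃ hε
      exact ⟨ε, h1, h2, h3, h4, h5, fun ha hb hc => (h ⟨ha, hb, hc⟩).elim⟩
  have hpos : ∀ {x : ℝ}, 1 ≤ x → 0 < ⌊x⌋₊ := fun h => Nat.floor_pos.2 h
  refine ⟨⌊2 * L * D ^ 2 / (β₁ ^ 2 * ε)⌋₊, ⌊(4 * D * R₂ / (β₁ * β₂ * ε)) ^ 2⌋₊,
    ⌊Real.log (4 * D * R₂ * C / (β₁ * β₃ * ε)) / (1 - α)⌋₊, hpos ha, hpos hb, hpos hc, ?_, ?_⟩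
  · intro n N X _ ν _ _ t ht htR hN z Θ hΘc hΘconv κ _ r _ θ₀ θstar hmix hstar hmin hDθ
    have hbound := MCMCLearning.schedule_bound hR₂ hL0 hC hα0 hα1 hD hβ₁ hβ₂ hβ₃ hβ hε0 hl.le hDδ
      ha hb hc rfl rfl rfl rfl
    set K := ⌊2 * L * D ^ 2 / (β₁ ^ 2 * ε)⌋₊
    set M := ⌊(4 * D * R₂ / (β₁ * β₂ * ε)) ^ 2⌋₊
    set v := ⌊Real.log (4 * D * R₂ * C / (β₁ * β₃ * ε)) / (1 - α)⌋₊
    have hne : Θ.Nonempty := ⟨θstar, hstar⟩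
    have hprob := MCMCLearning.one_sub_le_measure_errorSum_lt (ν := ν) (κ := κ) (z := z)
      (lam := lam) (L := L) r hR₂ ht htR hne hΘc hΘconv θ₀ (K := K) (M := M) (v := v)
      (hpos ha) (hpos hb) hδ0 hδ1 fun θ hθ => hmix θ hθ r inferInstance v
    have := MCMCLearning.isProbabilityMeasure_sampleLaw (M := M) (κ := κ) (z := z) (lam := lam)
      (L := L) r ht hne hΘc hΘconv θ₀ v K
    refine hprob.trans (measureReal_mono fun ω hω => ?_)
    have hω' := le_of_lt (Set.mem_ofPred_eq ▸ hω :)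
    have hS0 := MCMCLearning.errorSum_nonneg (ν := ν) (t := t) (z := z) (lam := lam) (L := L)
      (Θ := Θ) θ₀ K ω
    have hopt := MCMCLearning.objective_averageIterate_sub_le (ν := ν) (z := z) (L := L) hN hlam hL0
      (by nlinarith) hR₂.le ht htR hΘc hΘconv hstar hmin hDθ (hpos ha) ω
    refine hopt.trans (le_trans ?_ (hbound.trans hεle))
    -- The deterministic bound is increasing in the total error because that error is nonnegative
    -- (`hS0`).
    gcongr
  · intro ha' hb' hc'
    obtain rfl := hcase ha' hb' hc'
    have hK := Nat.floor_le (zero_le_one.trans ha')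
    have hM := Nat.floor_le (zero_le_one.trans hb')
    have hv := Nat.floor_le (zero_le_one.trans hc')
    -- Integer parts only decrease the three factors, and the product of the reals is exactly the
    -- claimed cost.
    calc _ ≤ 2 * L * D ^ 2 / (β₁ ^ 2 * ε) * (4 * D * R₂ / (β₁ * β₂ * ε)) ^ 2
          * (Real.log (4 * D * R₂ * C / (β₁ * β₃ * ε)) / (1 - α)) := by gcongr
      _ = _ := by
        have : 1 - α ≠ 0 := by linarith
        field_simp
        ring
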